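/- Let $d\ge 0$ and let $L\ge 3$ be an odd integer. For $N\ge 0$ let $\Lambda_N=(\mathbb Z/L^N\mathbb Z)^d$, let $\chi_N$ be the space of functions $\varphi:\Lambda_N\to\mathbb R$ with $\sum_x\varphi(x)=0$, write $(\varphi,\psi)=\sum_{x\in\Lambda_N}\varphi(x)\psi(x)$, $\nabla_i\varphi(x)=\varphi(x+e_i)-\varphi(x)$ and $\nabla_i^*\varphi(x)=\varphi(x-e_i)-\varphi(x)$. For each $N$ let $q^N\in\mathbb R^{d\times d}$ be symmetric with Euclidean operator norm $\|q^N\|\le\frac12$. Then (a) for every $N$ the operator $\mathcal A^{q^N}=\sum_{i,j}(\delta_{ij}+q^N_{ij})\nabla_j^*\nabla_i$ is invertible on $\chi_N$; write $\mathcal C^{q^N}$ for its inverse. (b) There are a subsequence $(N_k)$ and a matrix $\bar q$ with $q^{N_k}\to\bar q$. (c) Let $(N_k)$ be any strictly increasing sequence with $q^{N_k}\to\bar q$ for some matrix $\bar q$. Then $\bar q$ is symmetric. Put $\mathcal A=\sum_{i,j}(\delta_{ij}+\bar q_{ij})\partial_j^*\partial_i$ with $\partial_j^*=-\partial_j$ on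 $\mathbb T^d=\mathbb R^d/\mathbb Z^d$, and $\operatorname{div}^*=-\operatorname{div}$. For every $f\in L^2(\mathbb T^d;\mathbb R^d)$ the equation $\mathcal A u=\operatorname{div}^*f$ has a weak solution $u\in W^{1,2}(\mathbb T^d)$, that is, $$\sum_{i,j}(\delta_{ij}+\bar q_{ij})\int_{\mathbb T^d}\partial_iu\,\partial_j\psi\,dx=\int_{\mathbb T^d}f\cdot D\psi\,dx\qquad\text{for all }\psi\in W^{1,2}(\mathbb T^d),$$ and it is unique up to an additive constant; let $\mathcal C\operatorname{div}^*f$ denote the solution with mean zero. With $$f^N(x)=L^{-Nd/2}\,\frac1{|Q_x|}\int_{Q_x}f(y)\,dy,\qquad x\in\Lambda_N,$$ where $Q_x\subset\mathbb T^d$ is the cube of side length $L^{-N}$ centred at $L^{-N}x$, one has $$\Bigl(\sum_l\nabla_l^*f^{N_k}_l,\ \mathcal C^{q^{N_k}}\sum_l\nabla_l^*f^{N_k}_l\Bigr)\longrightarrow\bigl(f,\,D\,\mathcal C\operatorname{div}^*f\bigr)_{L^2(\mathbb T^d;\mathbb R^d)}\qquad(k\to\infty).$$ If $f:\mathbb T^d\to\mathbb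 R^d$ is continuous, the same convergence also holds with the pointwise scaling $f^N(x)=L^{-Nd/2}f(L^{-N}x)$. -/

import Mathlib

open MeasureTheory Filter Topology
open scoped ContDiff

noncomputable section

namespace GradientField

/-! ### The discrete torus -/

/-- The discrete torus `(ℤ / L^N ℤ)^d`. -/
abbrev DiscreteTorus (d L N : ℕ) := Fin d → ZMod (L ^ N)

/-- The forward difference `∇_i φ(x) = φ(x + e_i) - φ(x)`. -/
def nabla {d L N : ℕ} (i : Fin d) :
    (DiscreteTorus d L N → ℝ) →ₗ[ℝ] (DiscreteTorus d L N → ℝ) where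
  toFun φ := fun x => φ (x + Pi.single i 1) - φ x
  map_add' φ ψ := by
    funext x
    simp only [Pi.add_apply]
    ring
  map_smul' c φ := by
    funext x
    simp only [Pi.smul_apply, smul_eq_mul, RingHom.id_apply]
    ring

/-- The adjoint difference `∇_i^* φ(x) = φ(x - e_i) - φ(x)`. -/
def nablaStar {d L N : ℕ} (i : Fin d) :
    (DiscreteTorus d L N → ℝ) →ₗ[ℝ] (DiscreteTorus d L N → ℝ) where
  toFun φ := fun x => φ (x - Pi.single i 1) - φ x
  map_add' φ ψ := by
    funext x
    simp only [Pi.add_apply]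
    ring
  map_smul' c φ := by
    funext x
    simp only [Pi.smul_apply, smul_eq_mul, RingHom.id_apply]
    ring

/-- The space `χ_N` of fields on the discrete torus with vanishing sum. -/
def meanZero (d L N : ℕ) [NeZero L] : Submodule ℝ (DiscreteTorus d L N → ℝ) where
  carrier := {φ | ∑ x, φ x = 0}
  add_mem' {φ ψ} hφ hψ := by
    simp only [Set.mem_ofPred_eq] at hφ hψ ⊢
    simp [Finset.sum_add_distrib, hφ, hψ]
  zero_mem' := by simp
  smul_mem' c φ hφ := by
    simp only [Set.mem_ofPred_eq] at hφ ⊢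
    simp [← Finset.mul_sum, hφ]

theorem nablaStar_mem_meanZero {d L N : ℕ} [NeZero L] (i : Fin d)
    (φ : DiscreteTorus d L N → ℝ) : nablaStar i φ ∈ meanZero d L N := by
  change ∑ x, (φ (x - Pi.single i 1) - φ x) = 0
  rw [Finset.sum_sub_distrib, sub_eq_zero]
  exact (Equiv.subRight (Pi.single i 1 : DiscreteTorus d L N)).sum_comp φ

/-- The operator `𝒜^q = ∑_{i,j} (δ_{ij} + q_{ij}) ∇_j^* ∇_i` on all fields. -/
def ellipticAux {d L N : ℕ} (q : Matrix (Fin d) (Fin d) ℝ) :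
    (DiscreteTorus d L N → ℝ) →ₗ[ℝ] (DiscreteTorus d L N → ℝ) :=
  ∑ i, ∑ j, (1 + q) i j • (nablaStar j ∘ₗ nabla i)

theorem ellipticAux_mem_meanZero {d L N : ℕ} [NeZero L] (q : Matrix (Fin d) (Fin d) ℝ)
    (φ : DiscreteTorus d L N → ℝ) : ellipticAux q φ ∈ meanZero d L N := by
  simp only [ellipticAux, LinearMap.sum_apply, LinearMap.smul_apply, LinearMap.comp_apply]
  exact Submodule.sum_mem _ fun i _ => Submodule.sum_mem _ fun j _ =>
    Submodule.smul_mem _ _ (nablaStar_mem_meanZero j _)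

/-- The operator `𝒜^q = ∑_{i,j} (δ_{ij} + q_{ij}) ∇_j^* ∇_i` on the space `χ_N`. -/
def discreteElliptic (d L N : ℕ) [NeZero L] (q : Matrix (Fin d) (Fin d) ℝ) :
    Module.End ℝ (meanZero d L N) :=
  ((ellipticAux q).domRestrict (meanZero d L N)).codRestrict (meanZero d L N)
    fun φ => ellipticAux_mem_meanZero q φ.1

/-- The covariance `𝒞^q = (𝒜^q)⁻¹` on `χ_N`. -/
def discreteCov (d L N : ℕ) [NeZero L] (q : Matrix (Fin d) (Fin d) ℝ) :
    Module.End ℝ (meanZero d L N) :=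
  Ring.inverse (discreteElliptic d L N q)

/-- `∑_l ∇_l^* h_l ∈ χ_N` for a vector field `h` on the discrete torus. -/
def discreteDivStar {d L N : ℕ} [NeZero L]
    (h : DiscreteTorus d L N → EuclideanSpace ℝ (Fin d)) : meanZero d L N :=
  ⟨∑ l, nablaStar l (fun x => h x l),
    Submodule.sum_mem _ fun l _ => nablaStar_mem_meanZero l _⟩

/-- The quadratic form `(∑_l ∇_l^* h_l, 𝒞^q ∑_l ∇_l^* h_l)`, with the scalar product
`(φ, ψ) = ∑_x φ(x) ψ(x)`. -/
def discreteForm {d L N : ℕ} [NeZero L] (q : Matrix (Fin d) (Fin d) ℝ)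
    (h : DiscreteTorus d L N → EuclideanSpace ℝ (Fin d)) : ℝ :=
  ∑ x, (discreteDivStar h).1 x * (discreteCov d L N q (discreteDivStar h)).1 x

/-! ### Scaled fields -/

/-- The point `L^{-N} x` of the continuum torus `(ℝ / ℤ)^d`. -/
def latticePoint {d L N : ℕ} [NeZero L] (x : DiscreteTorus d L N) : UnitAddTorus (Fin d) :=
  fun i => ZMod.toAddCircle (x i)

/-- `f^N(x) = L^{-Nd/2} f(L^{-N} x)`. -/
def scaledPoint {d : ℕ} (L N : ℕ) [NeZero L]
    (f : UnitAddTorus (Fin d) → EuclideanSpace ℝ (Fin d)) (x : DiscreteTorus d L N) :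
    EuclideanSpace ℝ (Fin d) :=
  (L : ℝ) ^ (-((N : ℝ) * d / 2)) • f (latticePoint x)

/-- `f^N(x) = L^{-Nd/2} ⨍_{Q_x} f`, where `Q_x` is the cube of side length `L^{-N}` with
centre `L^{-N} x` (a ball for the sup metric of the torus). -/
def scaledAverage {d : ℕ} (L N : ℕ) [NeZero L]
    (f : UnitAddTorus (Fin d) → EuclideanSpace ℝ (Fin d)) (x : DiscreteTorus d L N) :
    EuclideanSpace ℝ (Fin d) :=
  (L : ℝ) ^ (-((N : ℝ) * d / 2)) •
    ⨍ y in Metric.ball (latticePoint x) (((L : ℝ) ^ N)⁻¹ / 2), f y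

/-! ### The continuum torus -/

/-- Smooth functions on `(ℝ / ℤ)^d`: the periodic lift to `ℝ^d` is smooth. -/
def IsSmooth {d : ℕ} (φ : UnitAddTorus (Fin d) → ℝ) : Prop :=
  ContDiff ℝ ∞ fun y : Fin d → ℝ => φ fun i => (y i : UnitAddCircle)

/-- The partial derivative `∂_i φ` of a function on `(ℝ / ℤ)^d`. -/
def partialDeriv {d : ℕ} (i : Fin d) (φ : UnitAddTorus (Fin d) → ℝ)
    (x : UnitAddTorus (Fin d)) : ℝ :=
  deriv (fun t : ℝ => φ (x + Pi.single i (t : UnitAddCircle))) 0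

/-- `G ∈ L²` is the weak gradient of `u`. -/
def IsWeakGradient {d : ℕ} (u : UnitAddTorus (Fin d) → ℝ)
    (G : UnitAddTorus (Fin d) → EuclideanSpace ℝ (Fin d)) : Prop :=
  MemLp G 2 ∧ ∀ φ, IsSmooth φ → ∀ i, ∫ x, u x * partialDeriv i φ x = -∫ x, G x i * φ x

/-- `u ∈ W^{1,2}((ℝ / ℤ)^d)`. -/
def MemW12 {d : ℕ} (u : UnitAddTorus (Fin d) → ℝ) : Prop :=
  MemLp u 2 ∧ ∃ G, IsWeakGradient u G

open Classical in
/-- The weak gradient `Du` of `u ∈ W^{1,2}` (unique almost everywhere). -/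
def weakGrad {d : ℕ} (u : UnitAddTorus (Fin d) → ℝ) :
    UnitAddTorus (Fin d) → EuclideanSpace ℝ (Fin d) :=
  if h : ∃ G, IsWeakGradient u G then h.choose else 0

/-- `div^* f = - div f` for `f ∈ L²`, as the functional `ψ ↦ ∫ f · Dψ` on `W^{1,2}`. -/
def divStar {d : ℕ} (f : UnitAddTorus (Fin d) → EuclideanSpace ℝ (Fin d))
    (ψ : UnitAddTorus (Fin d) → ℝ) : ℝ :=
  ∫ x, inner ℝ (f x) (weakGrad ψ x)

/-- `u ∈ W^{1,2}` is a weak solution of `∑_{i,j} a_{ij} ∂_j^* ∂_i u = F`. -/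
def IsWeakSolution {d : ℕ} (a : Matrix (Fin d) (Fin d) ℝ)
    (F : (UnitAddTorus (Fin d) → ℝ) → ℝ) (u : UnitAddTorus (Fin d) → ℝ) : Prop :=
  MemW12 u ∧ ∀ ψ, MemW12 ψ →
    ∑ i, ∑ j, a i j * ∫ x, weakGrad u x i * weakGrad ψ x j = F ψ

open Classical in
/-- The inverse `𝒞` of `𝒜 = ∑_{i,j} a_{ij} ∂_j^* ∂_i`: it maps `F` to the weak solution of
`𝒜 u = F` with mean zero. -/
def continuumCov {d : ℕ} (a : Matrix (Fin d) (Fin d) ℝ)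
    (F : (UnitAddTorus (Fin d) → ℝ) → ℝ) : UnitAddTorus (Fin d) → ℝ :=
  if h : ∃ u, IsWeakSolution a F u ∧ ∫ x, u x = 0 then h.choose else 0

/-- The limit `(f, D 𝒞 div^* f)_{L²}`. -/
def continuumForm {d : ℕ} (a : Matrix (Fin d) (Fin d) ℝ)
    (f : UnitAddTorus (Fin d) → EuclideanSpace ℝ (Fin d)) : ℝ :=
  ∫ x, inner ℝ (f x) (weakGrad (continuumCov a (divStar f)) x)

end GradientField

end

/-!
Both quadratic forms have the shape `(f, T f)` for a bounded operator `T` on square integrable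
vector fields. On the lattice `T = ∇ 𝒞^q ∇^*`; on the torus `T f = D 𝒞 div^* f`, obtained from
Lax–Milgram on the space of weak gradients, which is closed in `L²` by the Poincaré inequality
(`exists_solutionOperator`). Since `‖q‖ ≤ 1/2`, the matrix `1 + q` dominates half of the identity
(`HalfElliptic`). This makes the discrete operator injective on mean-zero fields, hence invertible,
and bounds the lattice operators `T` by `2` uniformly in `N` (`norm_discreteFlux_le`).

The convergence is first proved for Fourier modes. The discrete and the continuum operator both
send a mode in the direction `e_l` to the field with amplitudes
`κ_i conj κ_l z / ∑ a i j κ_i conj κ_j`, where `κ_i` is `2 π i p_i` on the torus and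
`exp (2 π i p_i L^{-N}) - 1` on the lattice (`isSolutionGradient_waveField`,
`discreteFlux_waveField`). This expression is homogeneous of degree zero in `κ`, so the lattice
amplitudes converge to the continuum ones, and the pairing with any continuous field converges as a
Riemann sum. Trigonometric polynomials are uniformly dense in the continuous fields, and the uniform
bound carries the convergence over to them (`tendsto_inner_discreteFlux`), which is the statement
for the pointwise scaling. Averaging over cubes does not increase the `L²` norm and agrees with the
pointwise scaling up to `o(1)` for continuous fields, so approximation in `L²` by continuous fields
gives the statement for cube averages (`tendsto_discreteForm_averageField`).
-/

noncomputable section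

namespace GradientField

/-! ### The discrete elliptic operator -/

/-- The quadratic form of the matrix `a` dominates half of the Euclidean one. -/
def HalfElliptic {d : ℕ} (a : Matrix (Fin d) (Fin d) ℝ) : Prop :=
  ∀ v : Fin d → ℝ, 1 / 2 * ∑ i, v i ^ 2 ≤ ∑ i, ∑ j, a i j * (v i * v j)

theorem halfElliptic_one_add {d : ℕ} {q : Matrix (Fin d) (Fin d) ℝ}
    (hq : ‖Matrix.toEuclideanCLM (n := Fin d) (𝕜 := ℝ) q‖ ≤ 1 / 2) : HalfElliptic (1 + q) := by
  intro v
  set w : EuclideanSpace ℝ (Fin d) := WithLp.toLp 2 v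
  have hw : ‖w‖ ^ 2 = ∑ i, v i ^ 2 := by simp [EuclideanSpace.norm_sq_eq, w]
  have h1 : inner ℝ w (Matrix.toEuclideanCLM (n := Fin d) (𝕜 := ℝ) q w)
      = ∑ i, ∑ j, q i j * (v i * v j) := by
    simp only [PiLp.inner_apply, Matrix.ofLp_toEuclideanCLM, w, Matrix.mulVec, dotProduct]
    refine Finset.sum_congr rfl fun i _ => ?_
    simp only [RCLike.inner_apply, conj_trivial, Finset.sum_mul]
    refine Finset.sum_congr rfl fun j _ => by ring
  have h2 : |inner ℝ w (Matrix.toEuclideanCLM (n := Fin d) (𝕜 := ℝ) q w)| ≤ 1 / 2 * ‖w‖ ^ 2 := by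
    refine (abs_real_inner_le_norm _ _).trans ?_
    have := (Matrix.toEuclideanCLM (n := Fin d) (𝕜 := ℝ) q).le_opNorm w
    nlinarith [norm_nonneg w, mul_le_mul_of_nonneg_right hq (norm_nonneg w)]
  have h3 : ∑ i, ∑ j, (1 + q) i j * (v i * v j)
      = ∑ i, v i ^ 2 + ∑ i, ∑ j, q i j * (v i * v j) := by
    simp [Matrix.add_apply, Matrix.one_apply, add_mul, Finset.sum_add_distrib, pow_two]
  rw [h3, ← h1, ← hw]
  linarith [neg_abs_le (inner ℝ w (Matrix.toEuclideanCLM (n := Fin d) (𝕜 := ℝ) q w))]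

section Discrete

variable {d L N : ℕ}

theorem nabla_apply (i : Fin d) (φ : DiscreteTorus d L N → ℝ) (x : DiscreteTorus d L N) :
    nabla i φ x = φ (x + Pi.single i 1) - φ x := rfl

theorem nablaStar_apply (i : Fin d) (φ : DiscreteTorus d L N → ℝ) (x : DiscreteTorus d L N) :
    nablaStar i φ x = φ (x - Pi.single i 1) - φ x := rfl

theorem ellipticAux_apply (q : Matrix (Fin d) (Fin d) ℝ) (φ : DiscreteTorus d L N → ℝ)
    (x : DiscreteTorus d L N) :
    ellipticAux q φ x = ∑ i, ∑ j, (1 + q) i j * nablaStar j (nabla i φ) x := by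
  simp [ellipticAux, LinearMap.sum_apply, Finset.sum_apply]

/-- Vector fields on the discrete torus, with the `ℓ²` norm. -/
abbrev LatticeField (d L N : ℕ) :=
  PiLp 2 fun _ : DiscreteTorus d L N => EuclideanSpace ℝ (Fin d)

/-- The discrete gradient `∇φ`. -/
def discreteGrad : (DiscreteTorus d L N → ℝ) →ₗ[ℝ] LatticeField d L N where
  toFun φ := WithLp.toLp 2 fun x => WithLp.toLp 2 fun i => nabla i φ x
  map_add' φ ψ := by ext; simp
  map_smul' c φ := by ext; simp

theorem discreteGrad_apply (φ : DiscreteTorus d L N → ℝ) (x : DiscreteTorus d L N) (i : Fin d) :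
    discreteGrad φ x i = nabla i φ x := rfl

variable [NeZero L]

theorem sum_mul_nablaStar (i : Fin d) (φ ψ : DiscreteTorus d L N → ℝ) :
    ∑ x, φ x * nablaStar i ψ x = ∑ x, nabla i φ x * ψ x := by
  simp only [nabla_apply, nablaStar_apply, mul_sub, sub_mul, Finset.sum_sub_distrib]
  congr 1
  exact Fintype.sum_equiv (Equiv.subRight (Pi.single i 1 : DiscreteTorus d L N)) _ _
    fun x => by simp

theorem sum_mul_ellipticAux (q : Matrix (Fin d) (Fin d) ℝ) (φ ψ : DiscreteTorus d L N → ℝ) :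
    ∑ x, φ x * ellipticAux q ψ x
      = ∑ x, ∑ i, ∑ j, (1 + q) i j * (nabla i ψ x * nabla j φ x) := by
  simp only [ellipticAux_apply, Finset.mul_sum]
  rw [Finset.sum_comm]
  conv_rhs => rw [Finset.sum_comm]
  refine Finset.sum_congr rfl fun i _ => ?_
  rw [Finset.sum_comm]
  conv_rhs => rw [Finset.sum_comm]
  refine Finset.sum_congr rfl fun j _ => ?_
  have := congrArg ((1 + q) i j * ·) (sum_mul_nablaStar j φ (nabla i ψ))
  simp only [Finset.mul_sum] at this
  convert this using 2 <;> ring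

theorem half_sum_sq_nabla_le {q : Matrix (Fin d) (Fin d) ℝ} (hq : HalfElliptic (1 + q))
    (φ : DiscreteTorus d L N → ℝ) :
    1 / 2 * ∑ x, ∑ i, nabla i φ x ^ 2 ≤ ∑ x, φ x * ellipticAux q φ x := by
  rw [sum_mul_ellipticAux, Finset.mul_sum]
  exact Finset.sum_le_sum fun x _ => hq fun i => nabla i φ x

theorem nabla_eq_zero_of_ellipticAux_eq_zero {q : Matrix (Fin d) (Fin d) ℝ}
    (hq : HalfElliptic (1 + q)) {φ : DiscreteTorus d L N → ℝ} (h : ellipticAux q φ = 0)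
    (i : Fin d) : nabla i φ = 0 := by
  have h1 := half_sum_sq_nabla_le hq φ
  simp only [h, Pi.zero_apply, mul_zero, Finset.sum_const_zero] at h1
  have h2 : ∑ x, ∑ i, nabla i φ x ^ 2 = 0 :=
    le_antisymm (by linarith) (by positivity)
  funext x
  rw [Finset.sum_eq_zero_iff_of_nonneg (fun _ _ => by positivity)] at h2
  have h3 := h2 x (Finset.mem_univ _)
  rw [Finset.sum_eq_zero_iff_of_nonneg (fun _ _ => by positivity)] at h3
  exact pow_eq_zero_iff (two_ne_zero) |>.1 (h3 i (Finset.mem_univ _))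

/-- A function on the discrete torus all of whose differences vanish is constant, because the unit
vectors generate the group. -/
theorem eq_of_nabla_eq_zero {φ : DiscreteTorus d L N → ℝ} (h : ∀ i, nabla i φ = 0)
    (x : DiscreteTorus d L N) : φ x = φ 0 := by
  let S : AddSubmonoid (DiscreteTorus d L N) :=
    { carrier := {y | ∀ z, φ (z + y) = φ z}
      zero_mem' := fun z => by simp
      add_mem' := fun {a b} ha hb z => by rw [← add_assoc, hb, ha] }
  have hS : ∀ i, (Pi.single i 1 : DiscreteTorus d L N) ∈ S := fun i z =>
    sub_eq_zero.1 (congrFun (h i) z)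
  have hx : x ∈ S := by
    have : x = ∑ i, (x i).val • (Pi.single i 1 : DiscreteTorus d L N) := by
      funext j
      rw [Finset.sum_apply, Finset.sum_eq_single j]
      · rw [Pi.smul_apply, Pi.single_eq_same, nsmul_eq_mul, mul_one, ZMod.natCast_zmod_val]
      · intro i _ hij
        rw [Pi.smul_apply, Pi.single_eq_of_ne hij.symm, smul_zero]
      · simp
    rw [this]
    exact S.sum_mem fun i _ => S.nsmul_mem (hS i) _
  simpa using hx 0

theorem isUnit_discreteElliptic {q : Matrix (Fin d) (Fin d) ℝ} (hq : HalfElliptic (1 + q)) :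
    IsUnit (discreteElliptic d L N q) := by
  rw [LinearMap.isUnit_iff_ker_eq_bot, LinearMap.ker_eq_bot']
  rintro ⟨φ, hφ⟩ h
  have h1 : ellipticAux q φ = 0 := congrArg Subtype.val h
  have h2 := eq_of_nabla_eq_zero (nabla_eq_zero_of_ellipticAux_eq_zero hq h1)
  have h3 : ∑ x, φ x = 0 := hφ
  have h4 : φ 0 = 0 := by
    rw [Finset.sum_congr rfl fun x _ => h2 x] at h3
    simpa [NeZero.ne L] using h3
  ext x
  simpa [h4] using h2 x

theorem ellipticAux_discreteCov {q : Matrix (Fin d) (Fin d) ℝ} (hq : HalfElliptic (1 + q))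
    (φ : meanZero d L N) : ellipticAux q (discreteCov d L N q φ).1 = φ.1 := by
  have h := Ring.mul_inverse_cancel _ (isUnit_discreteElliptic (L := L) (N := N) hq)
  exact congrArg Subtype.val (LinearMap.congr_fun h φ)

/-! ### The discrete solution operator on lattice vector fields -/

/-- `discreteDivStar` as a linear map. -/
def divStarLM : LatticeField d L N →ₗ[ℝ] meanZero d L N where
  toFun h := discreteDivStar h.ofLp
  map_add' h k := by
    ext x
    simp only [discreteDivStar, Finset.sum_apply, Submodule.coe_add, Pi.add_apply,
      nablaStar_apply, PiLp.add_apply, ← Finset.sum_add_distrib]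
    exact Finset.sum_congr rfl fun _ _ => by ring
  map_smul' c h := by
    ext x
    simp only [discreteDivStar, Finset.sum_apply, Submodule.coe_smul, Pi.smul_apply,
      nablaStar_apply, PiLp.smul_apply, smul_eq_mul, Finset.mul_sum, RingHom.id_apply]
    exact Finset.sum_congr rfl fun _ _ => by ring

/-- The operator `∇ 𝒞^q ∇^*` on lattice vector fields. -/
def discreteFlux (q : Matrix (Fin d) (Fin d) ℝ) : LatticeField d L N →ₗ[ℝ] LatticeField d L N :=
  discreteGrad ∘ₗ (meanZero d L N).subtype ∘ₗ discreteCov d L N q ∘ₗ divStarLM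

theorem sum_discreteDivStar_mul (h : LatticeField d L N) (φ : DiscreteTorus d L N → ℝ) :
    ∑ x, (discreteDivStar h.ofLp).1 x * φ x = inner ℝ h (discreteGrad φ) := by
  simp only [discreteDivStar, Finset.sum_apply, PiLp.inner_apply, Finset.sum_mul]
  rw [Finset.sum_comm]
  conv_rhs => rw [Finset.sum_comm]
  refine Finset.sum_congr rfl fun i _ => ?_
  simpa [discreteGrad_apply, mul_comm] using sum_mul_nablaStar i φ fun x => h x i

theorem discreteForm_eq_inner (q : Matrix (Fin d) (Fin d) ℝ) (h : LatticeField d L N) :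
    discreteForm q h.ofLp = inner ℝ h (discreteFlux q h) :=
  sum_discreteDivStar_mul h _

theorem discreteFlux_eq_of_ellipticAux_eq {q : Matrix (Fin d) (Fin d) ℝ}
    (hq : HalfElliptic (1 + q)) {h : LatticeField d L N} {φ : DiscreteTorus d L N → ℝ}
    (hφ : ellipticAux q φ = (discreteDivStar h.ofLp).1) : discreteFlux q h = discreteGrad φ := by
  have h1 : ellipticAux q ((discreteCov d L N q (discreteDivStar h.ofLp)).1 - φ) = 0 := by
    rw [map_sub, ellipticAux_discreteCov hq, hφ, sub_self]
  have h2 := nabla_eq_zero_of_ellipticAux_eq_zero hq h1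
  refine sub_eq_zero.1 ?_
  change discreteGrad (discreteCov d L N q (discreteDivStar h.ofLp)).1 - discreteGrad φ = 0
  rw [← map_sub]
  ext x i
  exact congrFun (h2 i) x

/-- Testing the equation with its own solution bounds `∇ 𝒞^q ∇^*` uniformly in `N`. -/
theorem norm_discreteFlux_le {q : Matrix (Fin d) (Fin d) ℝ} (hq : HalfElliptic (1 + q))
    (h : LatticeField d L N) : ‖discreteFlux q h‖ ≤ 2 * ‖h‖ := by
  set φ := (discreteCov d L N q (discreteDivStar h.ofLp)).1
  have h1 : ∑ x, φ x * ellipticAux q φ x = inner ℝ h (discreteFlux q h) := by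
    rw [ellipticAux_discreteCov hq, ← discreteForm_eq_inner]
    exact Finset.sum_congr rfl fun _ _ => mul_comm _ _
  have h2 : ‖discreteFlux q h‖ ^ 2 = ∑ x, ∑ i, nabla i φ x ^ 2 := by
    rw [PiLp.norm_sq_eq_of_L2]
    refine Finset.sum_congr rfl fun x _ => ?_
    rw [EuclideanSpace.norm_sq_eq]
    exact Finset.sum_congr rfl fun i _ => by rw [Real.norm_eq_abs, sq_abs]; rfl
  have h3 := half_sum_sq_nabla_le hq φ
  rw [h1, ← h2] at h3
  have h4 := real_inner_le_norm h (discreteFlux q h)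
  by_contra! h5
  have h6 : 0 < ‖discreteFlux q h‖ := lt_of_le_of_lt (by positivity) h5
  nlinarith

end Discrete

/-! ### Lattice cubes and Riemann sums -/

/-- The circle has total mass one, so all tori carry probability measures. -/
instance isProbabilityMeasure_unitAddCircle :
    IsProbabilityMeasure (volume : Measure UnitAddCircle) := ⟨UnitAddCircle.measure_univ⟩

section Cubes

variable {d L N : ℕ}

theorem tendsto_inv_scale {σ : ℕ → ℕ} (hL : 1 < L) (hσ : StrictMono σ) :
    Tendsto (fun k => ((L : ℝ) ^ σ k)⁻¹) atTop (𝓝 0) :=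
  (tendsto_pow_atTop_atTop_of_one_lt (by exact_mod_cast hL)).inv_tendsto_atTop.comp
    hσ.tendsto_atTop

theorem sq_scaling : ((L : ℝ) ^ (-((N : ℝ) * d / 2))) ^ 2 = (((L : ℝ) ^ N) ^ d)⁻¹ := by
  rw [← Real.rpow_natCast, ← Real.rpow_mul (Nat.cast_nonneg _), ← pow_mul, ← Real.rpow_natCast,
    ← Real.rpow_neg (Nat.cast_nonneg _)]
  congr 1
  push_cast
  ring

variable [NeZero L]

/-- The cube `Q_x` of side length `L^{-N}` centred at `L^{-N} x`. -/
def cube (x : DiscreteTorus d L N) : Set (UnitAddTorus (Fin d)) :=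
  Metric.ball (latticePoint x) (((L : ℝ) ^ N)⁻¹ / 2)

theorem one_le_scale : (1 : ℝ) ≤ (L : ℝ) ^ N :=
  one_le_pow₀ (by exact_mod_cast Nat.one_le_iff_ne_zero.2 (NeZero.ne L))

theorem measurableSet_cube (x : DiscreteTorus d L N) : MeasurableSet (cube x) :=
  Metric.isOpen_ball.measurableSet

theorem volume_cube (x : DiscreteTorus d L N) :
    volume (cube x) = ENNReal.ofReal ((((L : ℝ) ^ N) ^ d)⁻¹) := by
  have h0 := one_le_scale (L := L) (N := N)
  have h1 : (0 : ℝ) < ((L : ℝ) ^ N)⁻¹ := by positivity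
  rw [cube, ball_pi _ (by positivity), volume_pi_pi]
  have h2 : ∀ y : UnitAddCircle, volume (Metric.ball y (((L : ℝ) ^ N)⁻¹ / 2))
      = ENNReal.ofReal (((L : ℝ) ^ N)⁻¹) := fun y => by
    rw [← measure_congr AddCircle.closedBall_ae_eq_ball, AddCircle.volume_closedBall,
      mul_div_cancel₀ _ two_ne_zero, min_eq_right (inv_le_one_of_one_le₀ h0)]
  simp only [h2, Finset.prod_const, Finset.card_univ, Fintype.card_fin]
  rw [← ENNReal.ofReal_pow h1.le, inv_pow]

theorem volume_real_cube (x : DiscreteTorus d L N) :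
    volume.real (cube x) = (((L : ℝ) ^ N) ^ d)⁻¹ := by
  rw [Measure.real, volume_cube, ENNReal.toReal_ofReal (by positivity)]

theorem volume_cube_ne_zero (x : DiscreteTorus d L N) : volume (cube x) ≠ 0 := by
  have h0 := one_le_scale (L := L) (N := N)
  rw [volume_cube, Ne, ENNReal.ofReal_eq_zero, not_le]
  positivity

/-- Two distinct points of `ℤ / nℤ`, embedded in the circle, are at distance at least `1 / n`. -/
theorem inv_le_dist_toAddCircle {n : ℕ} [NeZero n] {j k : ZMod n} (h : j ≠ k) :
    (n : ℝ)⁻¹ ≤ dist (ZMod.toAddCircle j) (ZMod.toAddCircle k) := by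
  have hn : (0 : ℝ) < n := by exact_mod_cast Nat.pos_of_ne_zero (NeZero.ne n)
  rw [dist_eq_norm, ← map_sub]
  have h1 : ZMod.toAddCircle (j - k) ≠ 0 := by
    rw [Ne, ZMod.toAddCircle_eq_zero, sub_eq_zero]; exact h
  have h2 : n • ZMod.toAddCircle (j - k) = 0 := by
    rw [← map_nsmul]; simp
  have h3 : IsOfFinAddOrder (ZMod.toAddCircle (j - k)) :=
    isOfFinAddOrder_iff_nsmul_eq_zero.2 ⟨n, Nat.pos_of_ne_zero (NeZero.ne n), h2⟩
  have h4 := AddCircle.le_add_order_smul_norm_of_isOfFinAddOrder h3 h1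
  have h5 : addOrderOf (ZMod.toAddCircle (j - k)) ≤ n :=
    Nat.le_of_dvd (Nat.pos_of_ne_zero (NeZero.ne n)) (addOrderOf_dvd_of_nsmul_eq_zero h2)
  rw [nsmul_eq_mul] at h4
  rw [inv_le_iff_one_le_mul₀' hn]
  exact h4.trans (mul_le_mul_of_nonneg_right (by exact_mod_cast h5) (norm_nonneg _))

theorem pairwise_disjoint_cube :
    Pairwise (Function.onFun Disjoint (cube : DiscreteTorus d L N → Set _)) := by
  intro x y hxy
  obtain ⟨i, hi⟩ := Function.ne_iff.1 hxy
  refine Metric.ball_disjoint_ball ?_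
  have h1 := inv_le_dist_toAddCircle hi
  have h2 : dist (ZMod.toAddCircle (x i)) (ZMod.toAddCircle (y i))
      ≤ dist (latticePoint x) (latticePoint y) :=
    dist_le_pi_dist (latticePoint x) (latticePoint y) i
  push_cast at h1
  linarith

theorem card_discreteTorus : (Fintype.card (DiscreteTorus d L N) : ℝ) = ((L : ℝ) ^ N) ^ d := by
  simp [ZMod.card]

theorem iUnion_cube_ae_eq_univ :
    (⋃ x : DiscreteTorus d L N, cube x) =ᵐ[volume] Set.univ := by
  have h0 := one_le_scale (L := L) (N := N)
  rw [ae_eq_univ, prob_compl_eq_zero_iff (MeasurableSet.iUnion measurableSet_cube),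
    measure_iUnion pairwise_disjoint_cube measurableSet_cube, tsum_fintype]
  simp only [volume_cube, Finset.sum_const, nsmul_eq_mul, Finset.card_univ]
  rw [← ENNReal.ofReal_natCast, ← ENNReal.ofReal_mul (by positivity), card_discreteTorus,
    mul_inv_cancel₀ (by positivity), ENNReal.ofReal_one]

theorem sum_setIntegral_cube {F : Type*} [NormedAddCommGroup F] [NormedSpace ℝ F]
    {f : UnitAddTorus (Fin d) → F} (hf : Integrable f) :
    ∑ x : DiscreteTorus d L N, ∫ y in cube x, f y = ∫ y, f y := by
  rw [← integral_iUnion_fintype measurableSet_cube pairwise_disjoint_cube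
    fun x => hf.integrableOn, setIntegral_congr_set iUnion_cube_ae_eq_univ, setIntegral_univ]

/-- If `f` varies by at most `ε` on a cube, its average differs by at most `ε` from the value at
the centre. -/
theorem norm_average_cube_sub_le {F : Type*} [NormedAddCommGroup F] [NormedSpace ℝ F]
    [CompleteSpace F] {f : UnitAddTorus (Fin d) → F} (hf : Continuous f) {ε : ℝ}
    (x : DiscreteTorus d L N) (hε : ∀ y ∈ cube x, dist (f y) (f (latticePoint x)) ≤ ε) :
    ‖(⨍ y in cube x, f y) - f (latticePoint x)‖ ≤ ε := by
  have h := (convex_closedBall (f (latticePoint x)) ε).set_average_mem Metric.isClosed_closedBall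
    (volume_cube_ne_zero x) (measure_ne_top _ _) (f := f)
    ((ae_restrict_iff' (measurableSet_cube x)).2 (ae_of_all _ hε))
    (hf.integrable_of_hasCompactSupport (HasCompactSupport.of_compactSpace f)).integrableOn
  rwa [Metric.mem_closedBall, dist_eq_norm] at h

/-- On all sufficiently fine lattices, the cube averages of a continuous function are uniformly
close to its values at the centres. -/
theorem eventually_norm_average_cube_sub_le {F : Type*} [NormedAddCommGroup F] [NormedSpace ℝ F]
    [CompleteSpace F] {f : UnitAddTorus (Fin d) → F} (hf : Continuous f) (hL : 1 < L)
    {σ : ℕ → ℕ} (hσ : StrictMono σ) {ε : ℝ} (hε : 0 < ε) :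
    ∀ᶠ k in atTop, ∀ x : DiscreteTorus d L (σ k),
      ‖(⨍ y in cube x, f y) - f (latticePoint x)‖ ≤ ε := by
  obtain ⟨δ, hδ, h⟩ := Metric.uniformContinuous_iff.1
    (CompactSpace.uniformContinuous_of_continuous hf) ε hε
  filter_upwards [(tendsto_inv_scale hL hσ).eventually (gt_mem_nhds hδ)] with k hk x
  refine norm_average_cube_sub_le hf x fun y hy => (h ?_).le
  have h0 := one_le_scale (L := L) (N := σ k)
  have h1 : 0 < ((L : ℝ) ^ σ k)⁻¹ := by positivity
  rw [cube, Metric.mem_ball] at hy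
  linarith

theorem tendsto_riemannSum {F : Type*} [NormedAddCommGroup F] [NormedSpace ℝ F]
    [CompleteSpace F] {f : UnitAddTorus (Fin d) → F} (hf : Continuous f) (hL : 1 < L)
    {σ : ℕ → ℕ} (hσ : StrictMono σ) :
    Tendsto (fun k => (((L : ℝ) ^ σ k) ^ d)⁻¹ •
      ∑ x : DiscreteTorus d L (σ k), f (latticePoint x)) atTop (𝓝 (∫ y, f y)) := by
  rw [Metric.tendsto_nhds]
  intro ε hε
  filter_upwards [eventually_norm_average_cube_sub_le hf hL hσ (half_pos hε)] with k hk
  have h0 := one_le_scale (L := L) (N := σ k)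
  rw [← sum_setIntegral_cube (L := L) (N := σ k)
    (hf.integrable_of_hasCompactSupport (HasCompactSupport.of_compactSpace f)),
    Finset.smul_sum, dist_eq_norm, ← Finset.sum_sub_distrib]
  have h1 : ∀ x : DiscreteTorus d L (σ k),
      ‖(((L : ℝ) ^ σ k) ^ d)⁻¹ • f (latticePoint x) - ∫ y in cube x, f y‖
        ≤ (((L : ℝ) ^ σ k) ^ d)⁻¹ * (ε / 2) := fun x => by
    rw [← volume_real_cube x, ← measure_smul_setAverage _ (measure_ne_top _ _), ← smul_sub,
      norm_smul, Real.norm_of_nonneg measureReal_nonneg, norm_sub_rev]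
    exact mul_le_mul_of_nonneg_left (hk x) measureReal_nonneg
  refine (norm_sum_le_of_le _ fun x _ => h1 x).trans_lt ?_
  rw [Finset.sum_const, nsmul_eq_mul, Finset.card_univ, card_discreteTorus, ← mul_assoc,
    mul_inv_cancel₀ (by positivity)]
  linarith

/-! ### Scaled fields in `ℓ²` -/

variable (L N) in
/-- The pointwise scaling `f ↦ f^N` as a linear map. -/
def pointField : (UnitAddTorus (Fin d) → EuclideanSpace ℝ (Fin d)) →ₗ[ℝ] LatticeField d L N where
  toFun f := WithLp.toLp 2 (scaledPoint L N f)
  map_add' f g := by ext; simp [scaledPoint]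
  map_smul' c f := by ext; simp [scaledPoint, mul_left_comm]

variable (L N) in
/-- The scaled field of cube averages as an element of `ℓ²`. -/
def averageField (f : UnitAddTorus (Fin d) → EuclideanSpace ℝ (Fin d)) : LatticeField d L N :=
  WithLp.toLp 2 (scaledAverage L N f)

theorem norm_smul_field_le {h : DiscreteTorus d L N → EuclideanSpace ℝ (Fin d)} {ε : ℝ}
    (hε : 0 ≤ ε) (hh : ∀ x, ‖h x‖ ≤ ε) :
    ‖(WithLp.toLp 2 fun x => (L : ℝ) ^ (-((N : ℝ) * d / 2)) • h x : LatticeField d L N)‖ ≤ ε := by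
  have h0 := one_le_scale (L := L) (N := N)
  refine le_of_sq_le_sq ?_ hε
  rw [PiLp.norm_sq_eq_of_L2]
  calc ∑ x, ‖(L : ℝ) ^ (-((N : ℝ) * d / 2)) • h x‖ ^ 2
      ≤ ∑ _x : DiscreteTorus d L N, (((L : ℝ) ^ N) ^ d)⁻¹ * ε ^ 2 := by
        refine Finset.sum_le_sum fun x _ => ?_
        rw [norm_smul, mul_pow, Real.norm_eq_abs, sq_abs, sq_scaling]
        gcongr
        exact hh x
    _ = ε ^ 2 := by
        rw [Finset.sum_const, nsmul_eq_mul, Finset.card_univ, card_discreteTorus, ← mul_assoc,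
          mul_inv_cancel₀ (by positivity), one_mul]

theorem norm_pointField_le (f : C(UnitAddTorus (Fin d), EuclideanSpace ℝ (Fin d))) :
    ‖pointField L N f‖ ≤ ‖f‖ :=
  norm_smul_field_le (norm_nonneg f) fun _ => f.norm_coe_le_norm _

theorem averageField_sub {f g : UnitAddTorus (Fin d) → EuclideanSpace ℝ (Fin d)}
    (hf : Integrable f) (hg : Integrable g) :
    averageField L N (f - g) = averageField L N f - averageField L N g := by
  ext x : 1
  simp only [averageField, PiLp.sub_apply, scaledAverage, setAverage_eq]
  rw [← smul_sub, ← smul_sub, ← integral_sub hf.integrableOn hg.integrableOn]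
  rfl

/-- By Jensen's inequality on each cube, averaging does not increase the `L²` norm. -/
theorem norm_sq_averageField_le {f : UnitAddTorus (Fin d) → EuclideanSpace ℝ (Fin d)}
    (hf : MemLp f 2) : ‖averageField L N f‖ ^ 2 ≤ ∫ y, ‖f y‖ ^ 2 := by
  have hf1 : Integrable f := hf.integrable one_le_two
  have hf2 : Integrable fun y => ‖f y‖ ^ 2 := hf.integrable_norm_pow two_ne_zero
  rw [PiLp.norm_sq_eq_of_L2, ← sum_setIntegral_cube (L := L) (N := N) hf2]
  refine Finset.sum_le_sum fun x _ => ?_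
  have hconv : ConvexOn ℝ Set.univ fun v : EuclideanSpace ℝ (Fin d) => ‖v‖ ^ 2 :=
    convexOn_univ_norm.pow (fun _ _ => norm_nonneg _) 2
  have h := hconv.map_set_average_le (by fun_prop) isClosed_univ (volume_cube_ne_zero x)
    (measure_ne_top _ _) (ae_of_all _ fun _ => Set.mem_univ _) hf1.integrableOn hf2.integrableOn
  rw [← measure_smul_setAverage _ (measure_ne_top _ (cube x)), volume_real_cube, ← sq_scaling,
    smul_eq_mul]
  change ‖(L : ℝ) ^ (-((N : ℝ) * d / 2)) • ⨍ y in cube x, f y‖ ^ 2 ≤ _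
  rw [norm_smul, mul_pow, Real.norm_eq_abs, sq_abs]
  exact mul_le_mul_of_nonneg_left h (sq_nonneg _)

theorem tendsto_averageField_sub_pointField
    {f : UnitAddTorus (Fin d) → EuclideanSpace ℝ (Fin d)} (hf : Continuous f) (hL : 1 < L)
    {σ : ℕ → ℕ} (hσ : StrictMono σ) :
    Tendsto (fun k => ‖averageField L (σ k) f - pointField L (σ k) f‖) atTop (𝓝 0) := by
  rw [Metric.tendsto_nhds]
  intro ε hε
  filter_upwards [eventually_norm_average_cube_sub_le hf hL hσ (half_pos hε)] with k hk
  rw [dist_zero_right, norm_norm]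
  refine lt_of_le_of_lt ?_ (half_lt_self hε)
  have h : averageField L (σ k) f - pointField L (σ k) f
      = WithLp.toLp 2 fun x => (L : ℝ) ^ (-((σ k : ℝ) * d / 2)) •
        ((⨍ y in cube x, f y) - f (latticePoint x)) := by
    ext x : 1
    exact (smul_sub _ _ _).symm
  rw [h]
  exact norm_smul_field_le (half_pos hε).le hk

end Cubes

/-! ### Smooth functions on the torus -/

section Smooth

variable {d : ℕ}

/-- The covering map `ℝ^d → (ℝ / ℤ)^d`. -/
def toTorus (y : Fin d → ℝ) : UnitAddTorus (Fin d) := fun i => (y i : UnitAddCircle)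

theorem isOpenQuotientMap_toTorus : IsOpenQuotientMap (toTorus (d := d)) :=
  IsOpenQuotientMap.piMap fun _ => QuotientAddGroup.isOpenQuotientMap_mk

theorem toTorus_add_single (y : Fin d → ℝ) (i : Fin d) (t : ℝ) :
    toTorus y + Pi.single i (t : UnitAddCircle) = toTorus (y + t • Pi.single i 1) := by
  funext j
  by_cases h : j = i
  · subst h; simp [toTorus]
  · simp [toTorus, h]

theorem IsSmooth.continuous {φ : UnitAddTorus (Fin d) → ℝ} (h : IsSmooth φ) : Continuous φ :=
  isOpenQuotientMap_toTorus.isQuotientMap.continuous_iff.2 (ContDiff.continuous h)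

theorem isSmooth_const (c : ℝ) : IsSmooth fun _ : UnitAddTorus (Fin d) => c := contDiff_const

theorem IsSmooth.mul {φ ψ : UnitAddTorus (Fin d) → ℝ} (hφ : IsSmooth φ) (hψ : IsSmooth ψ) :
    IsSmooth fun x => φ x * ψ x := ContDiff.mul hφ hψ

theorem IsSmooth.differentiable_line {φ : UnitAddTorus (Fin d) → ℝ} (h : IsSmooth φ)
    (x : UnitAddTorus (Fin d)) (i : Fin d) :
    Differentiable ℝ fun t : ℝ => φ (x + Pi.single i (t : UnitAddCircle)) := by
  obtain ⟨y, rfl⟩ := isOpenQuotientMap_toTorus.surjective x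
  simp only [toTorus_add_single]
  have h1 : Differentiable ℝ fun y : Fin d → ℝ => φ (toTorus y) :=
    ContDiff.differentiable h (by simp)
  exact h1.comp (by fun_prop : Differentiable ℝ fun t : ℝ => y + t • (Pi.single i 1 : Fin d → ℝ))

theorem IsSmooth.hasDerivAt_line {φ : UnitAddTorus (Fin d) → ℝ} (h : IsSmooth φ)
    (x : UnitAddTorus (Fin d)) (i : Fin d) (t : ℝ) :
    HasDerivAt (fun t : ℝ => φ (x + Pi.single i (t : UnitAddCircle)))
      (partialDeriv i φ (x + Pi.single i (t : UnitAddCircle))) t := by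
  have h1 : partialDeriv i φ (x + Pi.single i (t : UnitAddCircle))
      = deriv (fun t : ℝ => φ (x + Pi.single i (t : UnitAddCircle))) t := by
    have h2 := deriv_comp_const_add (fun t : ℝ => φ (x + Pi.single i (t : UnitAddCircle))) t 0
    rw [add_zero] at h2
    rw [← h2, partialDeriv]
    simp only [AddCircle.coe_add, Pi.single_add, add_assoc]
  rw [h1]
  exact (h.differentiable_line x i t).hasDerivAt

theorem partialDeriv_eq_of_hasDerivAt {φ : UnitAddTorus (Fin d) → ℝ} {x : UnitAddTorus (Fin d)}
    {i : Fin d} {c : ℝ}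
    (h : HasDerivAt (fun t : ℝ => φ (x + Pi.single i (t : UnitAddCircle))) c 0) :
    partialDeriv i φ x = c := h.deriv

theorem IsSmooth.hasDerivAt_zero {φ : UnitAddTorus (Fin d) → ℝ} (h : IsSmooth φ)
    (x : UnitAddTorus (Fin d)) (i : Fin d) :
    HasDerivAt (fun t : ℝ => φ (x + Pi.single i (t : UnitAddCircle))) (partialDeriv i φ x) 0 := by
  simpa using h.hasDerivAt_line x i 0

theorem IsSmooth.partialDeriv {φ : UnitAddTorus (Fin d) → ℝ} (h : IsSmooth φ) (i : Fin d) :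
    IsSmooth (partialDeriv i φ) := by
  have h1 : ContDiff ℝ ∞ fun y : Fin d → ℝ =>
      fderiv ℝ (fun y : Fin d → ℝ => φ (toTorus y)) y (Pi.single i 1) :=
    (ContDiff.fderiv_right (m := ∞) h (by simp)).clm_apply contDiff_const
  have h4 : (fun y : Fin d → ℝ => fderiv ℝ (fun y : Fin d → ℝ => φ (toTorus y)) y
      (Pi.single i 1)) = fun y => GradientField.partialDeriv i φ (toTorus y) :=
    funext fun y => Eq.symm ?_
  · rwa [h4] at h1
  refine partialDeriv_eq_of_hasDerivAt (x := toTorus y) ?_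
  simp only [toTorus_add_single]
  have h2 : HasFDerivAt (fun y : Fin d → ℝ => φ (toTorus y))
      (fderiv ℝ (fun y : Fin d → ℝ => φ (toTorus y)) y) (y + (0 : ℝ) • Pi.single i 1) := by
    rw [zero_smul, add_zero]
    exact ((ContDiff.differentiable h (by simp)) y).hasFDerivAt
  have h3 : HasDerivAt (fun t : ℝ => y + t • (Pi.single i 1 : Fin d → ℝ)) (Pi.single i 1) 0 := by
    simpa using ((hasDerivAt_id (0 : ℝ)).smul_const (Pi.single i 1 : Fin d → ℝ)).const_add y
  exact h2.comp_hasDerivAt (0 : ℝ) h3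

theorem partialDeriv_mul {φ ψ : UnitAddTorus (Fin d) → ℝ} (hφ : IsSmooth φ) (hψ : IsSmooth ψ)
    (i : Fin d) (x : UnitAddTorus (Fin d)) :
    partialDeriv i (fun x => φ x * ψ x) x
      = partialDeriv i φ x * ψ x + φ x * partialDeriv i ψ x := by
  refine partialDeriv_eq_of_hasDerivAt ?_
  have h := (hφ.hasDerivAt_zero x i).mul (hψ.hasDerivAt_zero x i)
  simp only [AddCircle.coe_zero, Pi.single_zero, add_zero] at h
  exact h

theorem integrable_of_continuous {F : Type*} [NormedAddCommGroup F]
    {f : UnitAddTorus (Fin d) → F} (hf : Continuous f) : Integrable f :=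
  hf.integrable_of_hasCompactSupport (HasCompactSupport.of_compactSpace f)

theorem memLp_of_continuous {F : Type*} [NormedAddCommGroup F]
    {f : UnitAddTorus (Fin d) → F} (hf : Continuous f) : MemLp f 2 :=
  hf.memLp_of_hasCompactSupport (HasCompactSupport.of_compactSpace f)

/-- The integral of `φ(· + t e_i)` does not depend on `t`; differentiating it at `t = 0` shows that
partial derivatives have integral zero. -/
theorem integral_partialDeriv_eq_zero {φ : UnitAddTorus (Fin d) → ℝ} (h : IsSmooth φ)
    (i : Fin d) : ∫ x, partialDeriv i φ x = 0 := by
  have hc := (h.partialDeriv i).continuous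
  set b := ‖(⟨partialDeriv i φ, hc⟩ : C(UnitAddTorus (Fin d), ℝ))‖
  have hb : ∀ x, ‖partialDeriv i φ x‖ ≤ b :=
    (⟨partialDeriv i φ, hc⟩ : C(UnitAddTorus (Fin d), ℝ)).norm_coe_le_norm
  set F : ℝ → UnitAddTorus (Fin d) → ℝ := fun t x => φ (x + Pi.single i (t : UnitAddCircle))
  set F' : ℝ → UnitAddTorus (Fin d) → ℝ := fun t x =>
    partialDeriv i φ (x + Pi.single i (t : UnitAddCircle))
  have h0 : ∀ t, Continuous (F t) := fun t => h.continuous.comp (continuous_add_const _)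
  have h0' : Continuous (F' 0) := hc.comp (continuous_add_const _)
  have h1 : HasDerivAt (fun t => ∫ x, F t x) (∫ x, F' 0 x) 0 :=
    (hasDerivAt_integral_of_dominated_loc_of_deriv_le (s := Set.univ) (bound := fun _ => b)
      Filter.univ_mem (Eventually.of_forall fun t => (h0 t).aestronglyMeasurable)
      (integrable_of_continuous (h0 0)) h0'.aestronglyMeasurable
      (ae_of_all _ fun x t _ => hb _) (integrable_const _)
      (ae_of_all _ fun x t _ => h.hasDerivAt_line x i t)).2
  have h2 : (fun t => ∫ x, F t x) = fun _ => ∫ x, φ x :=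
    funext fun t => integral_add_right_eq_self φ _
  have h3 : ∫ x, F' 0 x = ∫ x, partialDeriv i φ x :=
    integral_add_right_eq_self (partialDeriv i φ) _
  rw [h2, h3] at h1
  exact h1.unique (hasDerivAt_const _ _)

theorem integral_mul_partialDeriv {φ ψ : UnitAddTorus (Fin d) → ℝ} (hφ : IsSmooth φ)
    (hψ : IsSmooth ψ) (i : Fin d) :
    ∫ x, φ x * partialDeriv i ψ x = -∫ x, partialDeriv i φ x * ψ x := by
  have h := integral_partialDeriv_eq_zero (hφ.mul hψ) i
  simp only [partialDeriv_mul hφ hψ] at h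
  have h1 := integral_add (μ := (volume : Measure (UnitAddTorus (Fin d))))
    (f := fun x => partialDeriv i φ x * ψ x) (g := fun x => φ x * partialDeriv i ψ x)
    (integrable_of_continuous ((hφ.partialDeriv i).continuous.mul hψ.continuous))
    (integrable_of_continuous (hφ.continuous.mul (hψ.partialDeriv i).continuous))
  linarith

/-! ### Fourier modes -/

open UnitAddTorus in
/-- The real Fourier mode `Re (z e^{2 π i p · x})`. -/
def mode (z : ℂ) (p : Fin d → ℤ) (x : UnitAddTorus (Fin d)) : ℝ := (z * mFourier p x).re

theorem mFourier_add_single (p : Fin d → ℤ) (x : UnitAddTorus (Fin d)) (i : Fin d) (t : ℝ) :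
    UnitAddTorus.mFourier p (x + Pi.single i (t : UnitAddCircle))
      = UnitAddTorus.mFourier p x * Complex.exp (2 * Real.pi * Complex.I * p i * t) := by
  have h1 : UnitAddTorus.mFourier p (x + Pi.single i (t : UnitAddCircle))
      = UnitAddTorus.mFourier p x * UnitAddTorus.mFourier p (Pi.single i (t : UnitAddCircle)) := by
    simp only [UnitAddTorus.mFourier, ContinuousMap.coe_mk, ← Finset.prod_mul_distrib, Pi.add_apply]
    exact Finset.prod_congr rfl fun j _ => by
      simp [fourier_apply, smul_add, AddCircle.toCircle_add]
  rw [h1]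
  congr 1
  simp only [UnitAddTorus.mFourier, ContinuousMap.coe_mk]
  rw [Finset.prod_eq_single i]
  · rw [Pi.single_eq_same, fourier_coe_apply]
    simp
  · intro j _ hj
    rw [Pi.single_eq_of_ne hj, fourier_eval_zero]
  · simp

theorem mFourier_toTorus (p : Fin d → ℤ) (y : Fin d → ℝ) :
    UnitAddTorus.mFourier p (toTorus y) =
      ∏ i, Complex.exp (2 * Real.pi * Complex.I * p i * y i) := by
  simp only [UnitAddTorus.mFourier, ContinuousMap.coe_mk, toTorus, fourier_coe_apply]
  simp

theorem isSmooth_mode (z : ℂ) (p : Fin d → ℤ) : IsSmooth (mode z p) := by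
  change ContDiff ℝ ∞ fun y : Fin d → ℝ => (z * UnitAddTorus.mFourier p (toTorus y)).re
  simp only [mFourier_toTorus]
  refine Complex.reCLM.contDiff.comp (contDiff_const.mul (contDiff_prod fun i _ => ?_))
  refine (Complex.contDiff_exp (𝕜 := ℝ)).comp (contDiff_const.mul ?_)
  exact Complex.ofRealCLM.contDiff.comp (contDiff_apply ℝ ℝ i)

theorem partialDeriv_mode (z : ℂ) (p : Fin d → ℤ) (i : Fin d) :
    partialDeriv i (mode z p) = mode (2 * Real.pi * Complex.I * p i * z) p := by
  funext x
  refine partialDeriv_eq_of_hasDerivAt ?_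
  simp only [mode, mFourier_add_single]
  have h1 : HasDerivAt (fun t : ℝ => (2 * Real.pi * Complex.I * p i * t : ℂ))
      (2 * Real.pi * Complex.I * p i) 0 := by
    simpa using (Complex.ofRealCLM.hasDerivAt (x := (0 : ℝ))).const_mul
      (2 * Real.pi * Complex.I * p i : ℂ)
  have h2 := (h1.cexp.const_mul (UnitAddTorus.mFourier p x)).const_mul z
  have h3 := Complex.reCLM.hasFDerivAt.comp_hasDerivAt (0 : ℝ) h2
  refine h3.congr_deriv ?_
  simp only [Complex.reCLM_apply, Complex.ofReal_zero, mul_zero, Complex.exp_zero]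
  congr 1
  ring

theorem integral_mul_mode {u : UnitAddTorus (Fin d) → ℝ} (hu : Integrable u) (z : ℂ)
    (p : Fin d → ℤ) :
    ∫ x, u x * mode z p x = (z * ∫ x, UnitAddTorus.mFourier p x * (u x : ℂ)).re := by
  have h1 : Integrable fun x => UnitAddTorus.mFourier p x * (u x : ℂ) :=
    hu.ofReal.bdd_mul (UnitAddTorus.mFourier p).continuous.aestronglyMeasurable
      (c := 1) (ae_of_all _ fun x =>
        ((UnitAddTorus.mFourier p).norm_coe_le_norm x).trans UnitAddTorus.mFourier_norm.le)
  rw [← integral_const_mul]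
  refine Eq.trans ?_ (integral_re (h1.const_mul z))
  refine integral_congr_ae (ae_of_all _ fun x => ?_)
  change u x * (z * _).re = (z * (_ * (u x : ℂ))).re
  rw [← mul_assoc, Complex.re_mul_ofReal, mul_comm]

theorem volume_unitAddCircle_eq_haar :
    (volume : Measure UnitAddCircle) = AddCircle.haarAddCircle := by
  rw [AddCircle.volume_eq_smul_haarAddCircle]; simp

/-- Mathlib states Parseval's identity for the measure `haarAddCircle` on each circle factor; the
measure is a parameter here so that the identity can be transferred to `volume`. -/
theorem hasSum_sq_integral_mFourier_aux (f : UnitAddTorus (Fin d) → ℂ)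
    (hf : MemLp f 2 (Measure.pi fun _ => AddCircle.haarAddCircle)) :
    HasSum (fun p : Fin d → ℤ => ‖∫ x, UnitAddTorus.mFourier (-p) x * f x
        ∂(Measure.pi fun _ => AddCircle.haarAddCircle)‖ ^ 2)
      (∫ x, ‖f x‖ ^ 2 ∂(Measure.pi fun _ => AddCircle.haarAddCircle)) := by
  have h := UnitAddTorus.hasSum_sq_mFourierCoeff (hf.toLp f)
  have h1 : ∀ p, UnitAddTorus.mFourierCoeff (hf.toLp f) p
      = ∫ x, UnitAddTorus.mFourier (-p) x * f x
        ∂(Measure.pi fun _ => AddCircle.haarAddCircle) := fun p =>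
    integral_congr_ae <| by filter_upwards [hf.coeFn_toLp] with x hx; rw [hx, smul_eq_mul]
  simp only [h1] at h
  convert h using 1
  exact integral_congr_ae <| by filter_upwards [hf.coeFn_toLp] with x hx; rw [hx]

theorem hasSum_sq_integral_mFourier {g : UnitAddTorus (Fin d) → ℝ} (hg : MemLp g 2) :
    HasSum (fun p : Fin d → ℤ => ‖∫ x, UnitAddTorus.mFourier (-p) x * (g x : ℂ)‖ ^ 2)
      (∫ x, g x ^ 2) := by
  have h0 : (volume : Measure (UnitAddTorus (Fin d)))
      = Measure.pi fun _ => AddCircle.haarAddCircle := by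
    rw [volume_pi, volume_unitAddCircle_eq_haar]
  have h1 : MemLp (fun x => (g x : ℂ)) 2 (volume : Measure (UnitAddTorus (Fin d))) := hg.ofReal
  rw [h0] at h1 ⊢
  simpa using hasSum_sq_integral_mFourier_aux _ h1

theorem ae_eq_zero_of_integral_mul_mode_eq_zero {g : UnitAddTorus (Fin d) → ℝ} (hg : MemLp g 2)
    (h : ∀ z p, ∫ x, g x * mode z p x = 0) : g =ᵐ[volume] 0 := by
  have h1 : ∀ p : Fin d → ℤ, ∫ x, UnitAddTorus.mFourier p x * (g x : ℂ) = 0 := fun p => by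
    -- the amplitude conjugate to the Fourier coefficient turns the integral into its square modulus
    have h2 := h (star (∫ x, UnitAddTorus.mFourier p x * (g x : ℂ))) p
    rw [integral_mul_mode (hg.integrable one_le_two)] at h2
    simpa [mul_comm, Complex.mul_conj, Complex.normSq_eq_norm_sq, ← Complex.ofReal_pow] using h2
  have h2 := hasSum_sq_integral_mFourier hg
  simp only [h1, norm_zero, ne_eq, OfNat.ofNat_ne_zero, not_false_eq_true, zero_pow] at h2
  have h3 : ∫ x, g x ^ 2 = 0 := h2.unique hasSum_zero
  rw [integral_eq_zero_iff_of_nonneg (fun _ => sq_nonneg _) hg.integrable_sq] at h3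
  filter_upwards [h3] with x hx
  exact pow_eq_zero_iff two_ne_zero |>.1 hx

end Smooth

/-! ### Weak gradients and the Poincaré inequality -/

section WeakGradient

variable {d : ℕ}

theorem memLp_apply {G : UnitAddTorus (Fin d) → EuclideanSpace ℝ (Fin d)} (hG : MemLp G 2)
    (i : Fin d) : MemLp (fun x => G x i) 2 :=
  (EuclideanSpace.proj (𝕜 := ℝ) i).comp_memLp' hG

/-- The classical gradient of a smooth function. -/
def smoothGrad (u : UnitAddTorus (Fin d) → ℝ) (x : UnitAddTorus (Fin d)) :
    EuclideanSpace ℝ (Fin d) := WithLp.toLp 2 fun i => partialDeriv i u x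

theorem IsSmooth.continuous_smoothGrad {u : UnitAddTorus (Fin d) → ℝ} (hu : IsSmooth u) :
    Continuous (smoothGrad u) :=
  (PiLp.continuous_toLp 2 _).comp (continuous_pi fun i => (hu.partialDeriv i).continuous)

theorem IsSmooth.isWeakGradient {u : UnitAddTorus (Fin d) → ℝ} (hu : IsSmooth u) :
    IsWeakGradient u (smoothGrad u) :=
  ⟨memLp_of_continuous hu.continuous_smoothGrad, fun _ hφ i => integral_mul_partialDeriv hu hφ i⟩

theorem integrable_mul_smooth {g φ : UnitAddTorus (Fin d) → ℝ} (hg : MemLp g 2)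
    (hφ : Continuous φ) : Integrable fun x => g x * φ x :=
  hg.integrable_mul (memLp_of_continuous hφ)

theorem IsWeakGradient.sub {u v : UnitAddTorus (Fin d) → ℝ}
    {G H : UnitAddTorus (Fin d) → EuclideanSpace ℝ (Fin d)} (hu : MemLp u 2) (hv : MemLp v 2)
    (hG : IsWeakGradient u G) (hH : IsWeakGradient v H) :
    IsWeakGradient (fun x => u x - v x) (fun x => G x - H x) := by
  refine ⟨hG.1.sub hH.1, fun φ hφ i => ?_⟩
  simp only [sub_mul, PiLp.sub_apply]
  rw [integral_sub (integrable_mul_smooth hu (hφ.partialDeriv i).continuous)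
      (integrable_mul_smooth hv (hφ.partialDeriv i).continuous),
    integral_sub (integrable_mul_smooth (memLp_apply hG.1 i) hφ.continuous)
      (integrable_mul_smooth (memLp_apply hH.1 i) hφ.continuous), hG.2 φ hφ i, hH.2 φ hφ i]
  ring

theorem IsWeakGradient.congr {u v : UnitAddTorus (Fin d) → ℝ}
    {G H : UnitAddTorus (Fin d) → EuclideanSpace ℝ (Fin d)} (hG : IsWeakGradient u G)
    (huv : u =ᵐ[volume] v) (hGH : G =ᵐ[volume] H) : IsWeakGradient v H := by
  refine ⟨hG.1.ae_eq hGH, fun φ hφ i => ?_⟩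
  have h1 : ∫ x, v x * partialDeriv i φ x = ∫ x, u x * partialDeriv i φ x :=
    integral_congr_ae (by filter_upwards [huv] with x hx; rw [hx])
  have h2 : ∫ x, H x i * φ x = ∫ x, G x i * φ x :=
    integral_congr_ae (by filter_upwards [hGH] with x hx; rw [hx])
  rw [h1, h2, hG.2 φ hφ i]

theorem IsWeakGradient.sub_const {u : UnitAddTorus (Fin d) → ℝ}
    {G : UnitAddTorus (Fin d) → EuclideanSpace ℝ (Fin d)} (hu : MemLp u 2)
    (hG : IsWeakGradient u G) (c : ℝ) : IsWeakGradient (fun x => u x - c) G := by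
  have h := hG.sub hu (memLp_const c) (isSmooth_const c).isWeakGradient
  refine h.congr ae_eq_rfl (ae_of_all _ fun x => ?_)
  ext i
  have h1 : partialDeriv i (fun _ : UnitAddTorus (Fin d) => c) x = 0 :=
    partialDeriv_eq_of_hasDerivAt (hasDerivAt_const _ _)
  simp [smoothGrad, h1]

theorem IsWeakGradient.ae_eq {u : UnitAddTorus (Fin d) → ℝ}
    {G H : UnitAddTorus (Fin d) → EuclideanSpace ℝ (Fin d)}
    (hG : IsWeakGradient u G) (hH : IsWeakGradient u H) : G =ᵐ[volume] H := by
  have h1 : ∀ i, (fun x => G x i - H x i) =ᵐ[volume] 0 := fun i => by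
    refine ae_eq_zero_of_integral_mul_mode_eq_zero
      ((memLp_apply hG.1 i).sub (memLp_apply hH.1 i)) fun z p => ?_
    have hs := isSmooth_mode z p
    simp only [sub_mul]
    rw [integral_sub (integrable_mul_smooth (memLp_apply hG.1 i) hs.continuous)
      (integrable_mul_smooth (memLp_apply hH.1 i) hs.continuous)]
    linarith [hG.2 _ hs i, hH.2 _ hs i]
  filter_upwards [ae_all_iff.2 h1] with x hx
  ext i
  exact sub_eq_zero.1 (hx i)

theorem isWeakGradient_weakGrad {u : UnitAddTorus (Fin d) → ℝ}
    {G : UnitAddTorus (Fin d) → EuclideanSpace ℝ (Fin d)} (hG : IsWeakGradient u G) :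
    IsWeakGradient u (weakGrad u) := by
  have h : ∃ G, IsWeakGradient u G := ⟨G, hG⟩
  rw [weakGrad, dif_pos h]
  exact h.choose_spec

theorem IsWeakGradient.weakGrad_ae_eq {u : UnitAddTorus (Fin d) → ℝ}
    {G : UnitAddTorus (Fin d) → EuclideanSpace ℝ (Fin d)} (hG : IsWeakGradient u G) :
    weakGrad u =ᵐ[volume] G :=
  (isWeakGradient_weakGrad hG).ae_eq hG

/-- Testing the definition of the weak gradient with modes: `∂_i` multiplies the `p`-th Fourier
coefficient by `2 π i p_i`. -/
theorem IsWeakGradient.integral_mFourier {u : UnitAddTorus (Fin d) → ℝ}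
    {G : UnitAddTorus (Fin d) → EuclideanSpace ℝ (Fin d)} (hu : MemLp u 2)
    (hG : IsWeakGradient u G) (p : Fin d → ℤ) (i : Fin d) :
    ∫ x, UnitAddTorus.mFourier p x * (G x i : ℂ)
      = -(2 * Real.pi * Complex.I * p i * ∫ x, UnitAddTorus.mFourier p x * (u x : ℂ)) := by
  set a := ∫ x, UnitAddTorus.mFourier p x * (u x : ℂ)
  set b := ∫ x, UnitAddTorus.mFourier p x * (G x i : ℂ)
  have h : ∀ z : ℂ, (z * (2 * Real.pi * Complex.I * p i * a + b)).re = 0 := fun z => by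
    have h1 := hG.2 _ (isSmooth_mode z p) i
    rw [partialDeriv_mode, integral_mul_mode (hu.integrable one_le_two),
      integral_mul_mode ((memLp_apply hG.1 i).integrable one_le_two)] at h1
    have h2 : z * (2 * Real.pi * Complex.I * p i * a + b)
        = 2 * Real.pi * Complex.I * p i * z * a + z * b := by ring
    rw [h2, Complex.add_re, h1]
    simp [b]
  -- with `z` the conjugate of the second factor, the real part is a square modulus
  have h3 := h (star (2 * Real.pi * Complex.I * p i * a + b))
  rw [mul_comm, Complex.star_def, Complex.mul_conj, Complex.ofReal_re, Complex.normSq_eq_zero] at h3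
  exact eq_neg_of_add_eq_zero_right h3

/-- The Poincaré inequality, by comparing Fourier coefficients. -/
theorem IsWeakGradient.integral_sq_le {u : UnitAddTorus (Fin d) → ℝ}
    {G : UnitAddTorus (Fin d) → EuclideanSpace ℝ (Fin d)} (hu : MemLp u 2)
    (hG : IsWeakGradient u G) (h0 : ∫ x, u x = 0) : ∫ x, u x ^ 2 ≤ ∫ x, ‖G x‖ ^ 2 := by
  have h1 : ∫ x, ‖G x‖ ^ 2 = ∑ i, ∫ x, G x i ^ 2 := by
    rw [← integral_finsetSum _ fun i _ => (memLp_apply hG.1 i).integrable_sq]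
    exact integral_congr_ae (ae_of_all _ fun x => by simp [EuclideanSpace.norm_sq_eq])
  rw [h1]
  refine hasSum_le (fun p => ?_) (hasSum_sq_integral_mFourier hu)
    (hasSum_sum fun i _ => hasSum_sq_integral_mFourier (memLp_apply hG.1 i))
  by_cases hp : p = 0
  · have h2 : ∫ x, UnitAddTorus.mFourier (-p) x * (u x : ℂ) = 0 := by
      simp only [hp, neg_zero, UnitAddTorus.mFourier_zero, ContinuousMap.one_apply, one_mul]
      rw [integral_complex_ofReal, h0, Complex.ofReal_zero]
    rw [h2, norm_zero, zero_pow two_ne_zero]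
    exact Finset.sum_nonneg fun _ _ => sq_nonneg _
  · obtain ⟨i, hi⟩ := Function.ne_iff.1 hp
    refine le_trans ?_ (Finset.single_le_sum
      (f := fun i => ‖∫ x, UnitAddTorus.mFourier (-p) x * (G x i : ℂ)‖ ^ 2)
      (fun _ _ => sq_nonneg _) (Finset.mem_univ i))
    simp only [hG.integral_mFourier hu]
    rw [norm_neg, norm_mul]
    -- a nonzero frequency gives a symbol of modulus at least one
    have h3 : (1 : ℝ) ≤ ‖(2 * Real.pi * Complex.I * ((-p) i : ℤ) : ℂ)‖ := by
      simp only [Pi.neg_apply, Int.cast_neg, mul_neg, norm_neg, norm_mul, Complex.norm_I, mul_one,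
        Complex.norm_ofNat, Complex.norm_real, Real.norm_eq_abs, abs_of_pos Real.pi_pos,
        Complex.norm_intCast]
      have h4 : (1 : ℝ) ≤ |(p i : ℝ)| := by exact_mod_cast Int.one_le_abs hi
      nlinarith [Real.pi_gt_three]
    gcongr
    exact le_mul_of_one_le_left (norm_nonneg _) h3

theorem ae_eq_const_of_isWeakGradient_zero {u : UnitAddTorus (Fin d) → ℝ} (hu : MemLp u 2)
    (h : IsWeakGradient u 0) : u =ᵐ[volume] fun _ => ∫ x, u x := by
  have hu' : MemLp (fun x => u x - ∫ y, u y) 2 := hu.sub (memLp_const _)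
  have h0 : ∫ x, (u x - ∫ y, u y) = 0 := by
    rw [integral_sub (hu.integrable one_le_two) (integrable_const _)]
    simp
  have h1 := (h.sub_const hu (∫ y, u y)).integral_sq_le hu' h0
  simp only [Pi.zero_apply, norm_zero, ne_eq, OfNat.ofNat_ne_zero, not_false_eq_true, zero_pow,
    integral_zero] at h1
  have h2 : ∫ x, (u x - ∫ y, u y) ^ 2 = 0 :=
    le_antisymm h1 (integral_nonneg fun _ => sq_nonneg _)
  rw [integral_eq_zero_iff_of_nonneg (fun _ => sq_nonneg _) hu'.integrable_sq] at h2
  filter_upwards [h2] with x hx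
  exact sub_eq_zero.1 (pow_eq_zero_iff two_ne_zero |>.1 hx)

/-! ### The Hilbert space of gradients -/

/-- Square integrable vector fields on the torus. -/
abbrev L2Field (d : ℕ) :=
  Lp (EuclideanSpace ℝ (Fin d)) 2 (volume : Measure (UnitAddTorus (Fin d)))

theorem inner_toLp {F : Type*} [NormedAddCommGroup F] [InnerProductSpace ℝ F]
    {f g : UnitAddTorus (Fin d) → F} (hf : MemLp f 2) (hg : MemLp g 2) :
    inner ℝ (hf.toLp f) (hg.toLp g) = ∫ x, inner ℝ (f x) (g x) := by
  rw [L2.inner_def]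
  refine integral_congr_ae ?_
  filter_upwards [hf.coeFn_toLp, hg.coeFn_toLp] with x h1 h2
  rw [h1, h2]

theorem norm_sq_toLp {F : Type*} [NormedAddCommGroup F] [InnerProductSpace ℝ F]
    {f : UnitAddTorus (Fin d) → F} (hf : MemLp f 2) : ‖hf.toLp f‖ ^ 2 = ∫ x, ‖f x‖ ^ 2 := by
  rw [← real_inner_self_eq_norm_sq, inner_toLp]
  simp only [real_inner_self_eq_norm_sq]

/-- The continuous functional `(u, G) ↦ ∫ u ∂_i φ + ∫ G_i φ`, whose vanishing for all `φ` and `i`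
says that `G` is the weak gradient of `u`. -/
def gradPairing (φ : {φ : UnitAddTorus (Fin d) → ℝ // IsSmooth φ}) (i : Fin d) :
    Lp ℝ 2 (volume : Measure (UnitAddTorus (Fin d))) × L2Field d →L[ℝ] ℝ :=
  (innerSL ℝ ((memLp_of_continuous (φ.2.partialDeriv i).continuous).toLp _)) ∘L
      ContinuousLinearMap.fst ℝ _ _ +
    (innerSL ℝ ((memLp_of_continuous
      (f := fun x => EuclideanSpace.single i (φ.1 x))
      ((PiLp.continuous_toLp 2 _).comp ((continuous_single i).comp φ.2.continuous))).toLp _)) ∘L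
      ContinuousLinearMap.snd ℝ _ _

/-- The continuous functional `(u, G) ↦ ∫ u`. -/
def meanPairing (d : ℕ) :
    Lp ℝ 2 (volume : Measure (UnitAddTorus (Fin d))) × L2Field d →L[ℝ] ℝ :=
  (innerSL ℝ ((memLp_const (1 : ℝ)).toLp _)) ∘L ContinuousLinearMap.fst ℝ _ _

theorem gradPairing_apply (φ : {φ : UnitAddTorus (Fin d) → ℝ // IsSmooth φ}) (i : Fin d)
    {u : UnitAddTorus (Fin d) → ℝ} {G : UnitAddTorus (Fin d) → EuclideanSpace ℝ (Fin d)}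
    (hu : MemLp u 2) (hG : MemLp G 2) :
    gradPairing φ i (hu.toLp u, hG.toLp G)
      = (∫ x, u x * partialDeriv i φ.1 x) + ∫ x, G x i * φ.1 x := by
  simp only [gradPairing, _root_.add_apply, ContinuousLinearMap.comp_apply,
    ContinuousLinearMap.coe_fst', ContinuousLinearMap.coe_snd', innerSL_apply_apply]
  rw [inner_toLp, inner_toLp]
  simp only [EuclideanSpace.inner_single_left, RCLike.inner_apply, conj_trivial, mul_comm]

theorem meanPairing_apply {u : UnitAddTorus (Fin d) → ℝ} (hu : MemLp u 2) (G : L2Field d) :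
    meanPairing d (hu.toLp u, G) = ∫ x, u x := by
  simp only [meanPairing, ContinuousLinearMap.comp_apply, ContinuousLinearMap.coe_fst',
    innerSL_apply_apply]
  rw [inner_toLp]
  simp

/-- The pairs `(u, Du)` with `u ∈ W^{1,2}` of mean zero, as a closed subspace of `L² × L²`. -/
def gradientGraph (d : ℕ) :
    Submodule ℝ (Lp ℝ 2 (volume : Measure (UnitAddTorus (Fin d))) × L2Field d) :=
  (meanPairing d).ker ⊓ ⨅ φ, ⨅ i, (gradPairing φ i).ker

theorem isClosed_gradientGraph :
    IsClosed (gradientGraph d :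
      Set (Lp ℝ 2 (volume : Measure (UnitAddTorus (Fin d))) × L2Field d)) := by
  simp only [gradientGraph, Submodule.coe_inf, Submodule.coe_iInf]
  exact (meanPairing d).isClosed_ker.inter
    (isClosed_iInter fun φ => isClosed_iInter fun i => (gradPairing φ i).isClosed_ker)

theorem mem_gradientGraph_iff {u : UnitAddTorus (Fin d) → ℝ}
    {G : UnitAddTorus (Fin d) → EuclideanSpace ℝ (Fin d)} (hu : MemLp u 2 volume)
    (hG : MemLp G 2 volume) :
    (hu.toLp u, hG.toLp G) ∈ gradientGraph d ↔ IsWeakGradient u G ∧ ∫ x, u x = 0 := by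
  simp only [gradientGraph, Submodule.mem_inf, Submodule.mem_iInf, LinearMap.mem_ker,
    ContinuousLinearMap.coe_coe, meanPairing_apply, gradPairing_apply, Subtype.forall,
    IsWeakGradient, hG, true_and, add_eq_zero_iff_eq_neg]
  tauto

theorem mem_gradientGraph_iff' (w : Lp ℝ 2 (volume : Measure (UnitAddTorus (Fin d))) × L2Field d) :
    w ∈ gradientGraph d ↔ IsWeakGradient (w.1 : UnitAddTorus (Fin d) → ℝ) w.2 ∧ ∫ x, w.1 x = 0 := by
  have h := mem_gradientGraph_iff (Lp.memLp w.1) (Lp.memLp w.2)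
  rwa [Lp.toLp_coeFn, Lp.toLp_coeFn] at h

/-- The map `(u, Du) ↦ Du`. -/
def graphSnd (d : ℕ) : gradientGraph d →L[ℝ] L2Field d :=
  ContinuousLinearMap.snd ℝ _ _ ∘L (gradientGraph d).subtypeL

/-- The space of weak gradients. -/
def gradientSpace (d : ℕ) : Submodule ℝ (L2Field d) := (graphSnd d).range

/-- By the Poincaré inequality `Du` controls `(u, Du)`, so the space of gradients is closed. -/
theorem isClosed_gradientSpace : IsClosed (gradientSpace d : Set (L2Field d)) := by
  have : CompleteSpace (gradientGraph d) := isClosed_gradientGraph.completeSpace_coe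
  have h : AntilipschitzWith 1 (graphSnd d) := by
    refine (graphSnd d).antilipschitz_of_bound fun w => ?_
    obtain ⟨w, hw⟩ := w
    have h1 := (mem_gradientGraph_iff' w).1 hw
    have h2 := h1.1.integral_sq_le (Lp.memLp w.1) h1.2
    have h3 : ‖w.1‖ ^ 2 ≤ ‖w.2‖ ^ 2 := by
      have h4 := norm_sq_toLp (Lp.memLp w.1)
      have h5 := norm_sq_toLp (Lp.memLp w.2)
      rw [Lp.toLp_coeFn] at h4 h5
      simpa [h4, h5] using h2
    rw [NNReal.coe_one, one_mul]
    exact max_le (le_of_sq_le_sq h3 (norm_nonneg _)) le_rfl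
  exact h.isClosed_range (graphSnd d).uniformContinuous

theorem mem_gradientSpace_iff {G : L2Field d} :
    G ∈ gradientSpace d ↔ ∃ u : UnitAddTorus (Fin d) → ℝ,
      MemLp u 2 ∧ IsWeakGradient u G ∧ ∫ x, u x = 0 := by
  constructor
  · rintro ⟨⟨w, hw⟩, rfl⟩
    exact ⟨w.1, Lp.memLp _, (mem_gradientGraph_iff' w).1 hw⟩
  · rintro ⟨u, hu, h⟩
    refine ⟨⟨(hu.toLp u, G), ?_⟩, rfl⟩
    have h1 := (mem_gradientGraph_iff hu (Lp.memLp G)).2 h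
    rwa [Lp.toLp_coeFn] at h1

theorem IsWeakGradient.toLp_mem_gradientSpace {u : UnitAddTorus (Fin d) → ℝ}
    {G : UnitAddTorus (Fin d) → EuclideanSpace ℝ (Fin d)} (hu : MemLp u 2)
    (hG : IsWeakGradient u G) : hG.1.toLp G ∈ gradientSpace d := by
  refine mem_gradientSpace_iff.2 ⟨fun x => u x - ∫ y, u y, hu.sub (memLp_const _),
    (hG.sub_const hu _).congr ae_eq_rfl hG.1.coeFn_toLp.symm, ?_⟩
  rw [integral_sub (hu.integrable one_le_two) (integrable_const _)]
  simp

end WeakGradient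

/-! ### The continuum solution operator -/

section Continuum

variable {d : ℕ}

/-- Pointwise multiplication of `L²` vector fields by the transpose of the matrix `a`, so that
`inner (coeffMul a G) H = ∑ a i j ∫ G_i H_j`. -/
def coeffMul (a : Matrix (Fin d) (Fin d) ℝ) : L2Field d →L[ℝ] L2Field d :=
  (Matrix.toEuclideanCLM (n := Fin d) (𝕜 := ℝ) a.transpose).compLpL 2 volume

theorem integrable_sum_sum_mul (a : Matrix (Fin d) (Fin d) ℝ) (G H : L2Field d) :
    Integrable fun x => ∑ i, ∑ j, a i j * (G x i * H x j) :=
  integrable_finsetSum _ fun i _ => integrable_finsetSum _ fun j _ =>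
    ((memLp_apply (Lp.memLp G) i).integrable_mul (memLp_apply (Lp.memLp H) j)).const_mul (a i j)

theorem integral_sum_sum_mul (a : Matrix (Fin d) (Fin d) ℝ) (G H : L2Field d) :
    ∫ x, ∑ i, ∑ j, a i j * (G x i * H x j) = ∑ i, ∑ j, a i j * ∫ x, G x i * H x j := by
  have hint : ∀ i j, Integrable fun x => a i j * (G x i * H x j) := fun i j =>
    ((memLp_apply (Lp.memLp G) i).integrable_mul (memLp_apply (Lp.memLp H) j)).const_mul (a i j)
  rw [integral_finsetSum _ fun i _ => integrable_finsetSum _ fun j _ => hint i j]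
  refine Finset.sum_congr rfl fun i _ => ?_
  rw [integral_finsetSum _ fun j _ => hint i j]
  exact Finset.sum_congr rfl fun j _ => integral_const_mul _ _

theorem inner_coeffMul (a : Matrix (Fin d) (Fin d) ℝ) (G H : L2Field d) :
    inner ℝ (coeffMul a G) H = ∑ i, ∑ j, a i j * ∫ x, G x i * H x j := by
  rw [L2.inner_def, ← integral_sum_sum_mul]
  refine integral_congr_ae ?_
  filter_upwards [(Matrix.toEuclideanCLM (n := Fin d) (𝕜 := ℝ) a.transpose).coeFn_compLpL G]
    with x hx
  rw [coeffMul, hx]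
  simp only [PiLp.inner_apply, Matrix.ofLp_toEuclideanCLM, Matrix.mulVec, dotProduct,
    Matrix.transpose_apply, RCLike.inner_apply, conj_trivial, Finset.mul_sum]
  rw [Finset.sum_comm]
  exact Finset.sum_congr rfl fun i _ => Finset.sum_congr rfl fun j _ => by ring

theorem half_norm_sq_le_inner_coeffMul {a : Matrix (Fin d) (Fin d) ℝ} (ha : HalfElliptic a)
    (G : L2Field d) : 1 / 2 * ‖G‖ ^ 2 ≤ inner ℝ (coeffMul a G) G := by
  have h1 := norm_sq_toLp (Lp.memLp G)
  rw [Lp.toLp_coeFn] at h1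
  rw [inner_coeffMul, h1, ← integral_const_mul, ← integral_sum_sum_mul]
  refine integral_mono (((Lp.memLp G).integrable_norm_pow two_ne_zero).const_mul _)
    (integrable_sum_sum_mul a G G) fun x => ?_
  simpa [EuclideanSpace.norm_sq_eq] using ha fun i => G x i

/-- `G` is the gradient of a weak solution of `∑ a i j ∂_j^* ∂_i u = div^* f`. -/
def IsSolutionGradient (a : Matrix (Fin d) (Fin d) ℝ) (f G : L2Field d) : Prop :=
  G ∈ gradientSpace d ∧ ∀ H ∈ gradientSpace d, inner ℝ (coeffMul a G) H = inner ℝ f H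

theorem IsSolutionGradient.unique {a : Matrix (Fin d) (Fin d) ℝ} (ha : HalfElliptic a)
    {f G G' : L2Field d} (hG : IsSolutionGradient a f G) (hG' : IsSolutionGradient a f G') :
    G = G' := by
  have hm := Submodule.sub_mem _ hG.1 hG'.1
  have h1 : inner ℝ (coeffMul a (G - G')) (G - G') = 0 := by
    rw [map_sub, inner_sub_left, hG.2 _ hm, hG'.2 _ hm, sub_self]
  have h2 := half_norm_sq_le_inner_coeffMul ha (G - G')
  rw [h1] at h2
  have h3 : ‖G - G'‖ ^ 2 = 0 := le_antisymm (by linarith) (sq_nonneg _)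
  exact sub_eq_zero.1 (norm_eq_zero.1 (pow_eq_zero_iff two_ne_zero |>.1 h3))

/-- By Lax–Milgram on the space of gradients, `f ↦ D 𝒞 div^* f` is a bounded operator on `L²`. -/
theorem exists_solutionOperator {a : Matrix (Fin d) (Fin d) ℝ} (ha : HalfElliptic a) :
    ∃ K : L2Field d →L[ℝ] L2Field d, ∀ f, IsSolutionGradient a f (K f) := by
  have : CompleteSpace (gradientSpace d) := isClosed_gradientSpace.completeSpace_coe
  let B : gradientSpace d →L[ℝ] gradientSpace d →L[ℝ] ℝ :=
    (innerSL ℝ).bilinearComp (coeffMul a ∘L (gradientSpace d).subtypeL) (gradientSpace d).subtypeL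
  have hB : ∀ v w, B v w = inner ℝ (coeffMul a (v : L2Field d)) (w : L2Field d) :=
    fun v w => rfl
  have hc : IsCoercive B := by
    refine ⟨1 / 2, by norm_num, fun v => ?_⟩
    rw [hB, mul_assoc, ← pow_two]
    exact half_norm_sq_le_inner_coeffMul ha (v : L2Field d)
  refine ⟨(gradientSpace d).subtypeL ∘L
    (hc.continuousLinearEquivOfBilin.symm : gradientSpace d →L[ℝ] gradientSpace d) ∘L
    (gradientSpace d).orthogonalProjectionOnto, fun f => ⟨Subtype.property _, fun H hH => ?_⟩⟩
  have h1 := hc.continuousLinearEquivOfBilin_apply (hc.continuousLinearEquivOfBilin.symm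
    ((gradientSpace d).orthogonalProjectionOnto f)) ⟨H, hH⟩
  rw [ContinuousLinearEquiv.apply_symm_apply, hB] at h1
  refine h1.symm.trans ?_
  exact (gradientSpace d).inner_orthogonalProjectionOnto_eq_of_mem_right ⟨H, hH⟩ f

theorem divStar_eq_inner {f : UnitAddTorus (Fin d) → EuclideanSpace ℝ (Fin d)} (hf : MemLp f 2)
    {ψ : UnitAddTorus (Fin d) → ℝ} (hψ : IsWeakGradient ψ (weakGrad ψ)) :
    divStar f ψ = inner ℝ (hf.toLp f) (hψ.1.toLp (weakGrad ψ)) := (inner_toLp _ _).symm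

theorem sum_integral_eq_inner (a : Matrix (Fin d) (Fin d) ℝ)
    {G H : UnitAddTorus (Fin d) → EuclideanSpace ℝ (Fin d)} (hG : MemLp G 2) (hH : MemLp H 2) :
    ∑ i, ∑ j, a i j * ∫ x, G x i * H x j = inner ℝ (coeffMul a (hG.toLp G)) (hH.toLp H) := by
  rw [inner_coeffMul]
  refine Finset.sum_congr rfl fun i _ => Finset.sum_congr rfl fun j _ => ?_
  congr 1
  refine integral_congr_ae ?_
  filter_upwards [hG.coeFn_toLp, hH.coeFn_toLp] with x h1 h2
  rw [h1, h2]

theorem MemW12.isWeakGradient {u : UnitAddTorus (Fin d) → ℝ} (hu : MemW12 u) :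
    IsWeakGradient u (weakGrad u) := isWeakGradient_weakGrad hu.2.choose_spec

theorem isWeakSolution_divStar_iff (a : Matrix (Fin d) (Fin d) ℝ)
    {f : UnitAddTorus (Fin d) → EuclideanSpace ℝ (Fin d)} (hf : MemLp f 2)
    {u : UnitAddTorus (Fin d) → ℝ} (hu : MemW12 u) :
    IsWeakSolution a (divStar f) u ↔
      IsSolutionGradient a (hf.toLp f) (hu.isWeakGradient.1.toLp (weakGrad u)) := by
  constructor
  · rintro ⟨-, h⟩
    refine ⟨hu.isWeakGradient.toLp_mem_gradientSpace hu.1, fun H hH => ?_⟩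
    obtain ⟨ψ, hψ, hH', -⟩ := mem_gradientSpace_iff.1 hH
    have hw : MemW12 ψ := ⟨hψ, H, hH'⟩
    have h1 := h ψ hw
    rw [divStar_eq_inner hf hw.isWeakGradient, sum_integral_eq_inner a hu.isWeakGradient.1
      hw.isWeakGradient.1] at h1
    have h2 : hw.isWeakGradient.1.toLp (weakGrad ψ) = H :=
      Lp.ext (hw.isWeakGradient.1.coeFn_toLp.trans hH'.weakGrad_ae_eq)
    rwa [h2] at h1
  · rintro ⟨-, h⟩
    refine ⟨hu, fun ψ hψ => ?_⟩
    rw [divStar_eq_inner hf hψ.isWeakGradient, sum_integral_eq_inner a hu.isWeakGradient.1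
      hψ.isWeakGradient.1]
    exact h _ (hψ.isWeakGradient.toLp_mem_gradientSpace hψ.1)

theorem continuumCov_spec {a : Matrix (Fin d) (Fin d) ℝ} (ha : HalfElliptic a)
    {f : UnitAddTorus (Fin d) → EuclideanSpace ℝ (Fin d)} (hf : MemLp f 2) :
    IsWeakSolution a (divStar f) (continuumCov a (divStar f)) ∧
      ∫ x, continuumCov a (divStar f) x = 0 := by
  have h : ∃ u, IsWeakSolution a (divStar f) u ∧ ∫ x, u x = 0 := by
    obtain ⟨K, hK⟩ := exists_solutionOperator ha
    obtain ⟨u, hu, hG, h0⟩ := mem_gradientSpace_iff.1 (hK (hf.toLp f)).1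
    have hw : MemW12 u := ⟨hu, _, hG⟩
    refine ⟨u, (isWeakSolution_divStar_iff a hf hw).2 ?_, h0⟩
    have h2 : hw.isWeakGradient.1.toLp (weakGrad u) = K (hf.toLp f) :=
      Lp.ext (hw.isWeakGradient.1.coeFn_toLp.trans hG.weakGrad_ae_eq)
    rw [h2]
    exact hK _
  rw [continuumCov, dif_pos h]
  exact h.choose_spec

theorem continuumForm_eq_inner {a : Matrix (Fin d) (Fin d) ℝ} (ha : HalfElliptic a)
    {f : UnitAddTorus (Fin d) → EuclideanSpace ℝ (Fin d)} (hf : MemLp f 2) {G : L2Field d}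
    (hG : IsSolutionGradient a (hf.toLp f) G) :
    continuumForm a f = inner ℝ (hf.toLp f) G := by
  have hs := (continuumCov_spec ha hf).1
  have h1 := ((isWeakSolution_divStar_iff a hf hs.1).1 hs).unique ha hG
  rw [← h1, inner_toLp]
  rfl

theorem ae_eq_add_const_of_isWeakSolution {a : Matrix (Fin d) (Fin d) ℝ} (ha : HalfElliptic a)
    {f : UnitAddTorus (Fin d) → EuclideanSpace ℝ (Fin d)} (hf : MemLp f 2)
    {u v : UnitAddTorus (Fin d) → ℝ} (hu : IsWeakSolution a (divStar f) u)
    (hv : IsWeakSolution a (divStar f) v) : ∃ c : ℝ, ∀ᵐ x, v x = u x + c := by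
  have h1 := ((isWeakSolution_divStar_iff a hf hv.1).1 hv).unique ha
    ((isWeakSolution_divStar_iff a hf hu.1).1 hu)
  have h2 : weakGrad v =ᵐ[volume] weakGrad u := (MemLp.toLp_eq_toLp_iff _ _).1 h1
  have h3 : IsWeakGradient (fun x => v x - u x) 0 := by
    refine (hv.1.isWeakGradient.sub hv.1.1 hu.1.1 hu.1.isWeakGradient).congr ae_eq_rfl ?_
    filter_upwards [h2] with x hx
    rw [hx, sub_self]
    rfl
  refine ⟨∫ x, (v x - u x), ?_⟩
  filter_upwards [ae_eq_const_of_isWeakGradient_zero (hv.1.1.sub hu.1.1) h3] with x hx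
  exact (sub_eq_iff_eq_add'.1 hx)

end Continuum

/-! ### Explicit solutions for Fourier modes -/

section Modes

variable {d L N : ℕ}

open scoped ComplexConjugate

/-- The Fourier symbol `∑ a i j κ_i conj κ_j` of the elliptic operator, where `κ_i` is the symbol
of the `i`-th derivative or difference. -/
def symbol (a : Matrix (Fin d) (Fin d) ℝ) (κ : Fin d → ℂ) : ℂ :=
  ∑ i, ∑ j, (a i j : ℂ) * (conj (κ j) * κ i)

/-- The amplitude of the solution with right-hand side the `l`-th adjoint derivative of a mode of
amplitude `z`. A vanishing symbol forces `κ = 0`, so the value `0` of the division by zero is then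
the right one. -/
def solAmp (a : Matrix (Fin d) (Fin d) ℝ) (κ : Fin d → ℂ) (l : Fin d) (z : ℂ) : ℂ :=
  conj (κ l) * z / symbol a κ

theorem half_sum_normSq_le_re_symbol {a : Matrix (Fin d) (Fin d) ℝ} (ha : HalfElliptic a)
    (κ : Fin d → ℂ) : 1 / 2 * ∑ i, Complex.normSq (κ i) ≤ (symbol a κ).re := by
  have h1 := add_le_add (ha fun i => (κ i).re) (ha fun i => (κ i).im)
  have h2 : ∑ i, Complex.normSq (κ i) = ∑ i, (κ i).re ^ 2 + ∑ i, (κ i).im ^ 2 := by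
    simp only [Complex.normSq_apply, pow_two, Finset.sum_add_distrib]
  have h3 : (symbol a κ).re = ∑ i, ∑ j, a i j * ((κ i).re * (κ j).re) +
      ∑ i, ∑ j, a i j * ((κ i).im * (κ j).im) := by
    simp only [symbol, Complex.re_sum, ← Finset.sum_add_distrib]
    refine Finset.sum_congr rfl fun i _ => Finset.sum_congr rfl fun j _ => ?_
    rw [Complex.re_ofReal_mul, Complex.mul_re, Complex.conj_re, Complex.conj_im]
    ring
  rw [h2, h3, mul_add]
  exact h1

theorem eq_zero_of_symbol_eq_zero {a : Matrix (Fin d) (Fin d) ℝ} (ha : HalfElliptic a)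
    {κ : Fin d → ℂ} (h : symbol a κ = 0) : κ = 0 := by
  have h1 := half_sum_normSq_le_re_symbol ha κ
  rw [h, Complex.zero_re] at h1
  have h2 : ∑ i, Complex.normSq (κ i) = 0 :=
    le_antisymm (by linarith) (Finset.sum_nonneg fun _ _ => Complex.normSq_nonneg _)
  rw [Finset.sum_eq_zero_iff_of_nonneg fun _ _ => Complex.normSq_nonneg _] at h2
  funext i
  exact Complex.normSq_eq_zero.1 (h2 i (Finset.mem_univ _))

theorem symbol_mul_solAmp {a : Matrix (Fin d) (Fin d) ℝ} (ha : HalfElliptic a)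
    (κ : Fin d → ℂ) (l : Fin d) (z : ℂ) : symbol a κ * solAmp a κ l z = conj (κ l) * z := by
  by_cases h : symbol a κ = 0
  · simp [eq_zero_of_symbol_eq_zero ha h, solAmp]
  · rw [solAmp, mul_div_cancel₀ _ h]

/-- The gradient amplitude `κ_i ζ` is homogeneous of degree zero in `κ`; this is why no power of
the lattice spacing appears in the limit. -/
theorem mul_solAmp_real_smul (a : Matrix (Fin d) (Fin d) ℝ) (κ : Fin d → ℂ) (l i : Fin d)
    (z : ℂ) {t : ℝ} (ht : t ≠ 0) :
    (t • κ) i * solAmp a (t • κ) l z = κ i * solAmp a κ l z := by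
  have h1 : symbol a (t • κ) = (t : ℂ) ^ 2 * symbol a κ := by
    simp only [symbol, Finset.mul_sum, Pi.smul_apply, Complex.real_smul, map_mul,
      Complex.conj_ofReal]
    exact Finset.sum_congr rfl fun i _ => Finset.sum_congr rfl fun j _ => by ring
  have ht' : (t : ℂ) ≠ 0 := by exact_mod_cast ht
  rw [solAmp, solAmp, h1]
  simp only [Pi.smul_apply, Complex.real_smul, map_mul, Complex.conj_ofReal]
  by_cases h : symbol a κ = 0
  · simp [h]
  · field_simp

theorem tendsto_mul_solAmp {a : ℕ → Matrix (Fin d) (Fin d) ℝ} {a' : Matrix (Fin d) (Fin d) ℝ}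
    {κ : ℕ → Fin d → ℂ} {κ' : Fin d → ℂ} (ha : Tendsto a atTop (𝓝 a'))
    (hκ : Tendsto κ atTop (𝓝 κ')) (h : symbol a' κ' ≠ 0) (l i : Fin d) (z : ℂ) :
    Tendsto (fun k => κ k i * solAmp (a k) (κ k) l z) atTop (𝓝 (κ' i * solAmp a' κ' l z)) := by
  have hκi : ∀ i, Tendsto (fun k => κ k i) atTop (𝓝 (κ' i)) := tendsto_pi_nhds.1 hκ
  have hc : ∀ i, Tendsto (fun k => conj (κ k i)) atTop (𝓝 (conj (κ' i))) := fun i =>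
    (Complex.continuous_conj.tendsto _).comp (hκi i)
  have haij : ∀ i j, Tendsto (fun k => (a k i j : ℂ)) atTop (𝓝 (a' i j : ℂ)) := fun i j =>
    (Complex.continuous_ofReal.tendsto _).comp (tendsto_pi_nhds.1 (tendsto_pi_nhds.1 ha i) j)
  refine (hκi i).mul (Tendsto.div ((hc l).mul_const z) ?_ h)
  exact tendsto_finsetSum _ fun i _ => tendsto_finsetSum _ fun j _ =>
    (haij i j).mul ((hc j).mul (hκi i))

theorem mode_sub (z w : ℂ) (p : Fin d → ℤ) (x : UnitAddTorus (Fin d)) :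
    mode (z - w) p x = mode z p x - mode w p x := by simp [mode, sub_mul]

theorem mode_sum {ι : Type*} (s : Finset ι) (z : ι → ℂ) (p : Fin d → ℤ)
    (x : UnitAddTorus (Fin d)) : mode (∑ i ∈ s, z i) p x = ∑ i ∈ s, mode (z i) p x := by
  simp only [mode, Finset.sum_mul, Complex.re_sum]

theorem mode_ofReal_mul (c : ℝ) (z : ℂ) (p : Fin d → ℤ) (x : UnitAddTorus (Fin d)) :
    mode (c * z) p x = c * mode z p x := by
  simp only [mode, mul_assoc, Complex.re_ofReal_mul]

theorem abs_mode_le (z : ℂ) (p : Fin d → ℤ) (x : UnitAddTorus (Fin d)) : |mode z p x| ≤ ‖z‖ := by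
  refine (Complex.abs_re_le_norm _).trans ?_
  rw [norm_mul]
  exact mul_le_of_le_one_right (norm_nonneg _)
    (((UnitAddTorus.mFourier p).norm_coe_le_norm x).trans UnitAddTorus.mFourier_norm.le)

/-- The vector field with components `Re (c_i e^{2 π i p · x})`. -/
def waveField (c : Fin d → ℂ) (p : Fin d → ℤ) :
    C(UnitAddTorus (Fin d), EuclideanSpace ℝ (Fin d)) where
  toFun x := WithLp.toLp 2 fun i => mode (c i) p x
  continuous_toFun := (PiLp.continuous_toLp 2 _).comp
    (continuous_pi fun i => (isSmooth_mode (c i) p).continuous)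

theorem waveField_apply (c : Fin d → ℂ) (p : Fin d → ℤ) (x : UnitAddTorus (Fin d)) (i : Fin d) :
    waveField c p x i = mode (c i) p x := rfl

theorem waveField_sub (c e : Fin d → ℂ) (p : Fin d → ℤ) :
    waveField (c - e) p = waveField c p - waveField e p := by
  ext x i
  exact mode_sub _ _ _ _

theorem norm_waveField_le (c : Fin d → ℂ) (p : Fin d → ℤ) : ‖waveField c p‖ ≤ ∑ i, ‖c i‖ := by
  refine (ContinuousMap.norm_le _ (Finset.sum_nonneg fun _ _ => norm_nonneg _)).2 fun x => ?_
  refine le_of_sq_le_sq ?_ (Finset.sum_nonneg fun _ _ => norm_nonneg _)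
  rw [EuclideanSpace.norm_sq_eq]
  refine le_trans (Finset.sum_le_sum fun i _ => ?_)
    (Finset.sum_sq_le_sq_sum_of_nonneg fun i _ => norm_nonneg (c i))
  exact pow_le_pow_left₀ (norm_nonneg _) (abs_mode_le _ _ _) 2

/-! ### The continuum mode -/

/-- The symbol of the partial derivatives at frequency `p`. -/
def derivSymbol (p : Fin d → ℤ) (i : Fin d) : ℂ := 2 * Real.pi * Complex.I * p i

theorem conj_derivSymbol (p : Fin d → ℤ) (i : Fin d) :
    conj (derivSymbol p i) = -derivSymbol p i := by
  simp [derivSymbol, map_ofNat (starRingEnd ℂ) 2]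

theorem integral_mode_mul_weakGradient {ψ : UnitAddTorus (Fin d) → ℝ}
    {G : UnitAddTorus (Fin d) → EuclideanSpace ℝ (Fin d)} (hψ : MemLp ψ 2)
    (hG : IsWeakGradient ψ G) (z : ℂ) (p : Fin d → ℤ) (i : Fin d) :
    ∫ x, mode z p x * G x i
      = (conj (derivSymbol p i) * z * ∫ x, UnitAddTorus.mFourier p x * (ψ x : ℂ)).re := by
  have h1 := hG.2 _ (isSmooth_mode z p) i
  rw [partialDeriv_mode, integral_mul_mode (hψ.integrable one_le_two)] at h1
  rw [conj_derivSymbol, neg_mul, neg_mul, Complex.neg_re, derivSymbol, h1, neg_neg]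
  simp only [mul_comm]

theorem isSolutionGradient_waveField {a : Matrix (Fin d) (Fin d) ℝ} (ha : HalfElliptic a)
    (l : Fin d) (z : ℂ) (p : Fin d → ℤ) :
    IsSolutionGradient a ((memLp_of_continuous (waveField (Pi.single l z) p).continuous).toLp _)
      ((memLp_of_continuous (waveField
        (fun i => derivSymbol p i * solAmp a (derivSymbol p) l z) p).continuous).toLp _) := by
  set ζ := solAmp a (derivSymbol p) l z
  have hs := isSmooth_mode ζ p
  have h0 : ⇑(waveField (fun i => derivSymbol p i * ζ) p) = smoothGrad (mode ζ p) := by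
    funext x
    ext i
    exact (congrFun (partialDeriv_mode ζ p i) x).symm
  constructor
  · simp only [h0]
    exact hs.isWeakGradient.toLp_mem_gradientSpace (memLp_of_continuous hs.continuous)
  · intro H hH
    obtain ⟨ψ, hψ, hG, -⟩ := mem_gradientSpace_iff.1 hH
    rw [← Lp.toLp_coeFn H (Lp.memLp H), ← sum_integral_eq_inner, inner_toLp]
    have h1 : ∀ x, inner ℝ (waveField (Pi.single l z) p x) (H x) = mode z p x * H x l := by
      intro x
      rw [PiLp.inner_apply, Finset.sum_eq_single l]
      · simp [waveField_apply, mul_comm]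
      · intro j _ hj
        simp [waveField_apply, Pi.single_eq_of_ne hj, mode]
      · simp
    simp only [h1, waveField_apply, integral_mode_mul_weakGradient hψ hG]
    rw [← symbol_mul_solAmp ha]
    simp only [symbol, Finset.sum_mul, Complex.re_sum]
    refine Finset.sum_congr rfl fun i _ => Finset.sum_congr rfl fun j _ => ?_
    rw [← Complex.re_ofReal_mul]
    congr 1
    ring

/-! ### The lattice mode -/

/-- The symbol of the forward differences on the lattice of spacing `t` at frequency `p`. -/
def diffSymbol (t : ℝ) (p : Fin d → ℤ) (i : Fin d) : ℂ :=
  Complex.exp (2 * Real.pi * Complex.I * p i * t) - 1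

theorem tendsto_inv_smul_diffSymbol (p : Fin d → ℤ) :
    Tendsto (fun t : ℝ => t⁻¹ • diffSymbol t p) (𝓝[≠] 0) (𝓝 (derivSymbol p)) := by
  refine tendsto_pi_nhds.2 fun i => ?_
  have h1 : HasDerivAt (fun t : ℝ => (2 * Real.pi * Complex.I * p i * t : ℂ))
      (2 * Real.pi * Complex.I * p i) 0 := by
    simpa using (Complex.ofRealCLM.hasDerivAt (x := (0 : ℝ))).const_mul
      (2 * Real.pi * Complex.I * p i : ℂ)
  have h2 := h1.cexp.tendsto_slope_zero
  simpa [diffSymbol, derivSymbol] using h2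

variable [NeZero L]

theorem latticePoint_add_single (x : DiscreteTorus d L N) (i : Fin d) :
    latticePoint (x + Pi.single i 1)
      = latticePoint x + Pi.single i ((((L : ℝ) ^ N)⁻¹ : ℝ) : UnitAddCircle) := by
  funext j
  by_cases h : j = i
  · subst h
    have h1 := ZMod.toAddCircle_intCast (N := L ^ N) 1
    simp only [latticePoint, Pi.add_apply, Pi.single_eq_same, map_add]
    congr 1
    simpa using h1
  · simp [latticePoint, h]

theorem latticePoint_sub_single (x : DiscreteTorus d L N) (i : Fin d) :
    latticePoint (x - Pi.single i 1)
      = latticePoint x + Pi.single i (((-((L : ℝ) ^ N)⁻¹ : ℝ)) : UnitAddCircle) := by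
  have h := latticePoint_add_single (x - Pi.single i 1) i
  rw [sub_add_cancel] at h
  rw [h, add_assoc, ← Pi.single_add, ← AddCircle.coe_add, add_neg_cancel, AddCircle.coe_zero,
    Pi.single_zero, add_zero]

theorem nabla_mode (z : ℂ) (p : Fin d → ℤ) (i : Fin d) (x : DiscreteTorus d L N) :
    nabla i (fun x => mode z p (latticePoint x)) x
      = mode (diffSymbol ((L : ℝ) ^ N)⁻¹ p i * z) p (latticePoint x) := by
  rw [nabla_apply, latticePoint_add_single]
  simp only [mode, mFourier_add_single, diffSymbol, ← Complex.sub_re]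
  congr 1
  ring

theorem nablaStar_mode (z : ℂ) (p : Fin d → ℤ) (i : Fin d) (x : DiscreteTorus d L N) :
    nablaStar i (fun x => mode z p (latticePoint x)) x
      = mode (conj (diffSymbol ((L : ℝ) ^ N)⁻¹ p i) * z) p (latticePoint x) := by
  have h : conj (diffSymbol ((L : ℝ) ^ N)⁻¹ p i)
      = Complex.exp (2 * Real.pi * Complex.I * p i * ((-((L : ℝ) ^ N)⁻¹ : ℝ) : ℂ)) - 1 := by
    simp [diffSymbol, ← Complex.exp_conj, map_ofNat (starRingEnd ℂ) 2]
  rw [nablaStar_apply, latticePoint_sub_single, h]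
  simp only [mode, mFourier_add_single, ← Complex.sub_re]
  congr 1
  ring

theorem ellipticAux_mode (q : Matrix (Fin d) (Fin d) ℝ) (z : ℂ) (p : Fin d → ℤ)
    (x : DiscreteTorus d L N) :
    ellipticAux q (fun x => mode z p (latticePoint x)) x
      = mode (symbol (1 + q) (diffSymbol ((L : ℝ) ^ N)⁻¹ p) * z) p (latticePoint x) := by
  have h : ∀ i, nabla i (fun x : DiscreteTorus d L N => mode z p (latticePoint x))
      = fun x => mode (diffSymbol ((L : ℝ) ^ N)⁻¹ p i * z) p (latticePoint x) :=
    fun i => funext fun x => nabla_mode z p i x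
  simp only [ellipticAux_apply, h, nablaStar_mode, symbol, Finset.sum_mul, mode_sum]
  refine Finset.sum_congr rfl fun i _ => Finset.sum_congr rfl fun j _ => ?_
  rw [← mode_ofReal_mul]
  congr 1
  ring

/-- The discrete solution operator maps lattice waves to lattice waves. -/
theorem discreteFlux_waveField {q : Matrix (Fin d) (Fin d) ℝ} (hq : HalfElliptic (1 + q))
    (l : Fin d) (z : ℂ) (p : Fin d → ℤ) :
    discreteFlux q (pointField L N (waveField (Pi.single l z) p))
      = pointField L N (waveField (fun i => diffSymbol ((L : ℝ) ^ N)⁻¹ p i *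
          solAmp (1 + q) (diffSymbol ((L : ℝ) ^ N)⁻¹ p) l z) p) := by
  set s : ℝ := (L : ℝ) ^ (-((N : ℝ) * d / 2))
  set κ : Fin d → ℂ := diffSymbol ((L : ℝ) ^ N)⁻¹ p
  set ζ := solAmp (1 + q) κ l z
  rw [discreteFlux_eq_of_ellipticAux_eq hq
    (φ := s • fun x => mode ζ p (latticePoint x))]
  · ext x i
    rw [map_smul]
    change s * nabla i (fun x => mode ζ p (latticePoint x)) x
      = s * mode (κ i * ζ) p (latticePoint x)
    rw [nabla_mode]
  · -- only the `l`-th component contributes to the divergence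
    rw [map_smul]
    funext x
    rw [Pi.smul_apply, ellipticAux_mode, symbol_mul_solAmp hq]
    simp only [discreteDivStar, Finset.sum_apply]
    rw [Finset.sum_eq_single l]
    · have h1 : (fun x => (pointField L N (waveField (Pi.single l z) p)).ofLp x l)
          = s • fun x : DiscreteTorus d L N => mode z p (latticePoint x) := by
        funext x
        change s * mode ((Pi.single l z : Fin d → ℂ) l) p (latticePoint x) = _
        rw [Pi.single_eq_same]
        rfl
      rw [h1, map_smul, Pi.smul_apply, nablaStar_mode]
    · intro j _ hj
      have h1 : (fun x => (pointField L N (waveField (Pi.single l z) p)).ofLp x j)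
          = (0 : DiscreteTorus d L N → ℝ) := by
        funext x
        change s * mode ((Pi.single l z : Fin d → ℂ) j) p (latticePoint x) = 0
        rw [Pi.single_eq_of_ne hj]
        simp [mode]
      rw [h1, map_zero, Pi.zero_apply]
    · simp

end Modes

/-! ### Convergence of the quadratic forms -/

section Convergence

variable {d : ℕ}

/-- For uniformly bounded linear functionals, the set of points of convergence to a given bounded
functional is closed. -/
theorem isClosed_setOf_tendsto_of_bound {V : Type*} [NormedAddCommGroup V] [NormedSpace ℝ V]
    {T : ℕ → V →ₗ[ℝ] ℝ} {T' : V →L[ℝ] ℝ} {C : ℝ} (hT : ∀ k v, |T k v| ≤ C * ‖v‖) :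
    IsClosed {v | Tendsto (fun k => T k v) atTop (𝓝 (T' v))} := by
  refine isClosed_of_closure_subset fun v hv => Metric.tendsto_atTop.2 fun ε hε => ?_
  set D := |C| + ‖T'‖ + 1
  have hD : 0 < D := by positivity
  obtain ⟨w, hw, hvw⟩ := Metric.mem_closure_iff.1 hv (ε / 2 / D) (by positivity)
  obtain ⟨k₀, hk₀⟩ := Metric.tendsto_atTop.1 hw (ε / 2) (half_pos hε)
  refine ⟨k₀, fun k hk => ?_⟩
  have h1 := hk₀ k hk
  rw [Real.dist_eq] at h1 ⊢
  rw [dist_eq_norm, lt_div_iff₀ hD] at hvw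
  have h2 : |T k (v - w)| ≤ |C| * ‖v - w‖ :=
    (hT k _).trans (mul_le_mul_of_nonneg_right (le_abs_self C) (norm_nonneg _))
  have h3 : |T' (v - w)| ≤ ‖T'‖ * ‖v - w‖ := T'.le_opNorm _
  have h4 : T k v - T' v = (T k w - T' w) + (T k (v - w) - T' (v - w)) := by
    rw [map_sub, map_sub]; ring
  rw [h4]
  have h5 := abs_add_le (T k w - T' w) (T k (v - w) - T' (v - w))
  have h6 := abs_sub (T k (v - w)) (T' (v - w))
  have h7 : (|C| + ‖T'‖) * ‖v - w‖ ≤ ‖v - w‖ * D := by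
    simp only [D]
    nlinarith [norm_nonneg (v - w)]
  linarith

/-- The inclusion of continuous vector fields into `L²`. -/
def contToL2 (d : ℕ) :
    C(UnitAddTorus (Fin d), EuclideanSpace ℝ (Fin d)) →L[ℝ] L2Field d :=
  ContinuousMap.toLp 2 volume ℝ

theorem contToL2_apply (f : C(UnitAddTorus (Fin d), EuclideanSpace ℝ (Fin d))) :
    contToL2 d f = (memLp_of_continuous f.continuous).toLp f :=
  Lp.ext ((ContinuousMap.coeFn_toLp volume f).trans (MemLp.coeFn_toLp _).symm)

section Lattice

variable {L : ℕ} [NeZero L]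

theorem inner_pointField {N : ℕ} (f g : UnitAddTorus (Fin d) → EuclideanSpace ℝ (Fin d)) :
    inner ℝ (pointField L N f) (pointField L N g) = (((L : ℝ) ^ N) ^ d)⁻¹ •
      ∑ x : DiscreteTorus d L N, inner ℝ (f (latticePoint x)) (g (latticePoint x)) := by
  rw [PiLp.inner_apply, Finset.smul_sum]
  refine Finset.sum_congr rfl fun x _ => ?_
  change inner ℝ ((_ : ℝ) • f (latticePoint x)) ((_ : ℝ) • g (latticePoint x)) = _
  rw [real_inner_smul_left, real_inner_smul_right, ← mul_assoc, ← pow_two, sq_scaling, smul_eq_mul]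

theorem tendsto_inner_pointField (hL : 1 < L) {σ : ℕ → ℕ} (hσ : StrictMono σ)
    (f g : C(UnitAddTorus (Fin d), EuclideanSpace ℝ (Fin d))) :
    Tendsto (fun k => inner ℝ (pointField L (σ k) f) (pointField L (σ k) g)) atTop
      (𝓝 (inner ℝ (contToL2 d f) (contToL2 d g))) := by
  rw [contToL2_apply, contToL2_apply, inner_toLp]
  simp only [inner_pointField]
  exact tendsto_riemannSum (f.continuous.inner g.continuous) hL hσ

/-- The amplitudes of the discrete solutions converge to those of the continuum solution. -/
theorem tendsto_diffSymbol_mul_solAmp (hL : 1 < L) {σ : ℕ → ℕ} (hσ : StrictMono σ)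
    {a : ℕ → Matrix (Fin d) (Fin d) ℝ} {a' : Matrix (Fin d) (Fin d) ℝ} (ha' : HalfElliptic a')
    (ha : Tendsto a atTop (𝓝 a')) (l i : Fin d) (z : ℂ) (p : Fin d → ℤ) :
    Tendsto (fun k => diffSymbol ((L : ℝ) ^ σ k)⁻¹ p i *
        solAmp (a k) (diffSymbol ((L : ℝ) ^ σ k)⁻¹ p) l z) atTop
      (𝓝 (derivSymbol p i * solAmp a' (derivSymbol p) l z)) := by
  -- the symbols of a constant mode vanish; otherwise rescale by the lattice spacing
  by_cases hp : p = 0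
  · simp [hp, diffSymbol, derivSymbol]
  · have hne : ∀ k, ((L : ℝ) ^ σ k)⁻¹ ≠ 0 := fun k =>
      inv_ne_zero (pow_ne_zero _ (Nat.cast_ne_zero.2 (NeZero.ne L)))
    have h1 : Tendsto (fun k => ((L : ℝ) ^ σ k)⁻¹) atTop (𝓝[≠] 0) :=
      tendsto_nhdsWithin_iff.2 ⟨tendsto_inv_scale hL hσ, Eventually.of_forall hne⟩
    have h2 : symbol a' (derivSymbol p) ≠ 0 := fun h => hp <| funext fun i => by
      simpa [derivSymbol, Real.pi_ne_zero] using
        congrFun (eq_zero_of_symbol_eq_zero ha' h) i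
    refine (tendsto_mul_solAmp ha ((tendsto_inv_smul_diffSymbol p).comp h1) h2 l i z).congr
      fun k => ?_
    exact mul_solAmp_real_smul _ _ _ _ _ (inv_ne_zero (hne k))

variable (hL : 1 < L) {σ : ℕ → ℕ} (hσ : StrictMono σ) {q : ℕ → Matrix (Fin d) (Fin d) ℝ}
  {q' : Matrix (Fin d) (Fin d) ℝ} (hq : ∀ k, HalfElliptic (1 + q k)) (hq' : HalfElliptic (1 + q'))
  (hlim : Tendsto q atTop (𝓝 q')) {K : L2Field d →L[ℝ] L2Field d}
  (hK : ∀ f, IsSolutionGradient (1 + q') f (K f))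

include hL hσ hq hq' hlim hK

theorem tendsto_inner_discreteFlux_waveField
    (h : C(UnitAddTorus (Fin d), EuclideanSpace ℝ (Fin d))) (l : Fin d) (z : ℂ) (p : Fin d → ℤ) :
    Tendsto (fun k => inner ℝ (pointField L (σ k) h)
        (discreteFlux (q k) (pointField L (σ k) (waveField (Pi.single l z) p)))) atTop
      (𝓝 (inner ℝ (contToL2 d h) (K (contToL2 d (waveField (Pi.single l z) p))))) := by
  set c : Fin d → ℂ := fun i => derivSymbol p i * solAmp (1 + q') (derivSymbol p) l z
  set ck : ℕ → Fin d → ℂ := fun k i => diffSymbol ((L : ℝ) ^ σ k)⁻¹ p i *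
    solAmp (1 + q k) (diffSymbol ((L : ℝ) ^ σ k)⁻¹ p) l z
  have hc : ∀ i, Tendsto (fun k => ck k i) atTop (𝓝 (c i)) := fun i =>
    tendsto_diffSymbol_mul_solAmp hL hσ hq' (hlim.const_add 1) l i z p
  have h1 : K (contToL2 d (waveField (Pi.single l z) p)) = contToL2 d (waveField c p) := by
    rw [contToL2_apply, contToL2_apply]
    exact (hK _).unique hq' (isSolutionGradient_waveField hq' l z p)
  have h2 : Tendsto (fun k => inner ℝ (pointField L (σ k) h)
      (pointField L (σ k) (waveField (ck k - c) p))) atTop (𝓝 0) := by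
    have h3 : Tendsto (fun k => ‖h‖ * ∑ i, ‖(ck k - c) i‖) atTop (𝓝 0) := by
      have h4 := (tendsto_finsetSum Finset.univ fun i _ =>
        tendsto_iff_norm_sub_tendsto_zero.1 (hc i)).const_mul ‖h‖
      simpa using h4
    refine squeeze_zero_norm (fun k => ?_) h3
    refine (abs_real_inner_le_norm (pointField L (σ k) h)
      (pointField L (σ k) (waveField (ck k - c) p))).trans ?_
    exact mul_le_mul (norm_pointField_le h) ((norm_pointField_le _).trans (norm_waveField_le _ _))
      (norm_nonneg _) (norm_nonneg _)
  have h5 := (tendsto_inner_pointField hL hσ h (waveField c p)).add h2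
  rw [add_zero] at h5
  rw [h1]
  refine h5.congr fun k => ?_
  rw [discreteFlux_waveField (hq k), ← inner_add_right, waveField_sub, ContinuousMap.coe_sub,
    map_sub, add_sub_cancel]

/-- Trigonometric polynomials are uniformly dense in the continuous fields and the discrete
solution operators are uniformly bounded, so convergence passes from modes to continuous fields. -/
theorem tendsto_inner_discreteFlux (h f : C(UnitAddTorus (Fin d), EuclideanSpace ℝ (Fin d))) :
    Tendsto (fun k => inner ℝ (pointField L (σ k) h)
        (discreteFlux (q k) (pointField L (σ k) f))) atTop
      (𝓝 (inner ℝ (contToL2 d h) (K (contToL2 d f)))) := by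
  let V := C(UnitAddTorus (Fin d), EuclideanSpace ℝ (Fin d))
  let T : ℕ → V →ₗ[ℝ] ℝ := fun k => (innerSL ℝ (pointField L (σ k) h)).toLinearMap ∘ₗ
    discreteFlux (q k) ∘ₗ pointField L (σ k) ∘ₗ ContinuousMap.coeFnLinearMap ℝ
  let T' : V →L[ℝ] ℝ := innerSL ℝ (contToL2 d h) ∘L K ∘L contToL2 d
  have hT : ∀ k v, |T k v| ≤ ‖h‖ * 2 * ‖v‖ := fun k v => by
    refine (abs_real_inner_le_norm (pointField L (σ k) h)
      (discreteFlux (q k) (pointField L (σ k) v))).trans ?_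
    rw [mul_assoc]
    refine mul_le_mul (norm_pointField_le h) ((norm_discreteFlux_le (hq k) _).trans ?_)
      (norm_nonneg _) (norm_nonneg _)
    exact mul_le_mul_of_nonneg_left (norm_pointField_le v) two_pos.le
  let M : Set V := {v | Tendsto (fun k => T k v) atTop (𝓝 (T' v))}
  have hM : IsClosed M := isClosed_setOf_tendsto_of_bound hT
  -- the field `Re (z F) e_l`, depending continuously on the complex function `F`
  let J : Fin d → ℂ → C(UnitAddTorus (Fin d), ℂ) →L[ℝ] V := fun l z =>
    ContinuousLinearMap.compLeftContinuous ℝ _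
      (((ContinuousLinearMap.id ℝ ℝ).smulRight (EuclideanSpace.single l (1 : ℝ))) ∘L
        Complex.reCLM ∘L (ContinuousLinearMap.mul ℝ ℂ z))
  have hJ : ∀ l z F x, J l z F x = (z * F x).re • EuclideanSpace.single l (1 : ℝ) :=
    fun l z F x => rfl
  let S : Fin d → Submodule ℂ C(UnitAddTorus (Fin d), ℂ) := fun l =>
    { carrier := {F | ∀ z, J l z F ∈ M}
      zero_mem' := fun z => by simp [M]
      add_mem' := fun {F G} hF hG z => by
        simpa [M] using (hF z).add (hG z)
      smul_mem' := fun c F hF z => by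
        have h1 : J l z (c • F) = J l (z * c) F := by
          ext1 x
          rw [hJ, hJ, ContinuousMap.smul_apply, smul_eq_mul, mul_assoc]
        rw [h1]
        exact hF _ }
  have hS : ∀ l, S l = ⊤ := fun l => by
    have h1 : IsClosed (S l : Set C(UnitAddTorus (Fin d), ℂ)) := by
      have h2 : (S l : Set C(UnitAddTorus (Fin d), ℂ)) = ⋂ z, J l z ⁻¹' M := by
        ext F; simp [S]
      rw [h2]
      exact isClosed_iInter fun z => hM.preimage (J l z).continuous
    rw [eq_top_iff, ← UnitAddTorus.span_mFourier_closure_eq_top]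
    refine Submodule.topologicalClosure_minimal _ (Submodule.span_le.2 ?_) h1
    rintro _ ⟨p, rfl⟩ z
    have h2 : J l z (UnitAddTorus.mFourier p) = waveField (Pi.single l z) p := by
      ext x i
      rw [hJ, waveField_apply]
      by_cases hi : i = l
      · subst hi; simp [mode]
      · simp [mode, hi]
    rw [h2]
    exact tendsto_inner_discreteFlux_waveField hL hσ hq hq' hlim hK h l z p
  have hf : f = ∑ l, J l 1 ⟨fun x => (f x l : ℂ), by fun_prop⟩ := by
    ext x i
    rw [ContinuousMap.sum_apply]
    simp only [hJ, one_mul, ContinuousMap.coe_mk, Complex.ofReal_re]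
    simp [Finset.sum_apply, Pi.single_apply]
  have hfl : ∀ l, J l 1 ⟨fun x => (f x l : ℂ), by fun_prop⟩ ∈ M := fun l => by
    have h1 : (⟨fun x => (f x l : ℂ), by fun_prop⟩ : C(UnitAddTorus (Fin d), ℂ)) ∈ S l := by
      rw [hS]; trivial
    exact h1 1
  have h3 := tendsto_finsetSum Finset.univ fun l _ => hfl l
  simp only [← map_sum] at h3
  rw [← hf] at h3
  exact h3

/-- Cube averages of a square integrable field are handled by approximation in `L²` with
continuous fields. -/
theorem tendsto_discreteForm_averageField
    {f : UnitAddTorus (Fin d) → EuclideanSpace ℝ (Fin d)} (hf : MemLp f 2) :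
    Tendsto (fun k => inner ℝ (averageField L (σ k) f)
        (discreteFlux (q k) (averageField L (σ k) f))) atTop
      (𝓝 (inner ℝ (hf.toLp f) (K (hf.toLp f)))) := by
  set F := hf.toLp f
  have hcont : Continuous fun v : L2Field d => inner ℝ v (K v) := by fun_prop
  rw [Metric.tendsto_nhds]
  intro ε hε
  -- the difference of the two quadratic forms is at most `2 η (2 ‖F‖ + η)` for an `ℓ²` error `η`
  obtain ⟨η, hη, hηε⟩ : ∃ η : ℝ, 0 < η ∧ 2 * η * (2 * ‖F‖ + η) < ε / 3 := by
    have h1 : Tendsto (fun η : ℝ => 2 * η * (2 * ‖F‖ + η)) (𝓝[>] 0) (𝓝 0) := by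
      refine tendsto_nhdsWithin_of_tendsto_nhds ?_
      have : Continuous fun η : ℝ => 2 * η * (2 * ‖F‖ + η) := by fun_prop
      simpa using this.tendsto 0
    obtain ⟨η, h2, h3⟩ := ((h1.eventually (gt_mem_nhds (by positivity : (0 : ℝ) < ε / 3))).and
      self_mem_nhdsWithin).exists
    exact ⟨η, h3, h2⟩
  obtain ⟨g, hg1, hg2⟩ : ∃ g : C(UnitAddTorus (Fin d), EuclideanSpace ℝ (Fin d)),
      ‖F - contToL2 d g‖ < η / 2 ∧
        dist (inner ℝ (contToL2 d g) (K (contToL2 d g))) (inner ℝ F (K F)) < ε / 3 := by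
    have hd : DenseRange (contToL2 d) :=
      ContinuousMap.toLp_denseRange _ volume ℝ (by norm_num)
    have ho : IsOpen ({v : L2Field d | ‖F - v‖ < η / 2} ∩
        {v | dist (inner ℝ v (K v)) (inner ℝ F (K F)) < ε / 3}) :=
      (isOpen_lt (by fun_prop) continuous_const).inter
        (isOpen_lt (hcont.dist continuous_const) continuous_const)
    obtain ⟨g, hg⟩ := hd.exists_mem_open ho ⟨F, by simpa using hη, by simpa using hε⟩
    exact ⟨g, hg⟩
  have hgL := memLp_of_continuous g.continuous
  filter_upwards [(tendsto_averageField_sub_pointField g.continuous hL hσ).eventually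
      (gt_mem_nhds (half_pos hη)),
    Metric.tendsto_nhds.1 (tendsto_inner_discreteFlux hL hσ hq hq' hlim hK g g) (ε / 3)
      (by positivity)] with k hk1 hk2
  have hb : ∀ {h : UnitAddTorus (Fin d) → EuclideanSpace ℝ (Fin d)} (hh : MemLp h 2),
      ‖averageField L (σ k) h‖ ≤ ‖hh.toLp h‖ := fun hh => by
    refine le_of_sq_le_sq ?_ (norm_nonneg _)
    rw [norm_sq_toLp]
    exact norm_sq_averageField_le hh
  set A := averageField L (σ k) f
  set P := pointField L (σ k) g
  have h1 : ‖A - P‖ ≤ η := by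
    have h2 : A - P = averageField L (σ k) (f - ⇑g) + (averageField L (σ k) g - P) := by
      rw [averageField_sub (hf.integrable one_le_two) (hgL.integrable one_le_two)]
      abel
    have h3 := hb (hf.sub hgL)
    rw [MemLp.toLp_sub hf hgL, ← contToL2_apply] at h3
    rw [h2]
    exact (norm_add_le _ _).trans (by linarith)
  have h4 : ‖A‖ ≤ ‖F‖ := hb hf
  have h5 : ‖P‖ ≤ ‖F‖ + η := by
    have := norm_sub_norm_le P A
    rw [norm_sub_rev] at this
    linarith
  have h6 : inner ℝ A (discreteFlux (q k) A) - inner ℝ P (discreteFlux (q k) P)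
      = inner ℝ A (discreteFlux (q k) (A - P)) + inner ℝ (A - P) (discreteFlux (q k) P) := by
    rw [map_sub, inner_sub_right, inner_sub_left]
    ring
  have h7 : |inner ℝ A (discreteFlux (q k) (A - P))| ≤ ‖F‖ * (2 * η) :=
    (abs_real_inner_le_norm _ _).trans (mul_le_mul h4
      ((norm_discreteFlux_le (hq k) _).trans (by linarith)) (norm_nonneg _) (norm_nonneg _))
  have h8 : |inner ℝ (A - P) (discreteFlux (q k) P)| ≤ η * (2 * (‖F‖ + η)) :=
    (abs_real_inner_le_norm _ _).trans (mul_le_mul h1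
      ((norm_discreteFlux_le (hq k) _).trans (by linarith)) (norm_nonneg _) hη.le)
  rw [Real.dist_eq] at hg2 hk2 ⊢
  have h9 := abs_add_le (inner ℝ A (discreteFlux (q k) (A - P)))
    (inner ℝ (A - P) (discreteFlux (q k) P))
  rw [← h6] at h9
  have h10 := abs_sub_le (inner ℝ A (discreteFlux (q k) A)) (inner ℝ P (discreteFlux (q k) P))
    (inner ℝ F (K F))
  have h11 := abs_sub_le (inner ℝ P (discreteFlux (q k) P))
    (inner ℝ (contToL2 d g) (K (contToL2 d g))) (inner ℝ F (K F))
  linarith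

end Lattice

/-! ### Compactness of the parameters -/

theorem abs_apply_le_norm_toEuclideanCLM (q : Matrix (Fin d) (Fin d) ℝ) (i j : Fin d) :
    |q i j| ≤ ‖Matrix.toEuclideanCLM (n := Fin d) (𝕜 := ℝ) q‖ := by
  have h1 := (Matrix.toEuclideanCLM (n := Fin d) (𝕜 := ℝ) q).le_opNorm (EuclideanSpace.single j 1)
  rw [PiLp.norm_single, norm_one, mul_one] at h1
  refine le_trans ?_ ((PiLp.norm_apply_le _ i).trans h1)
  simp [Matrix.ofLp_toEuclideanCLM, Matrix.mulVec_single]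

theorem exists_tendsto_subseq {q : ℕ → Matrix (Fin d) (Fin d) ℝ}
    (hq : ∀ N, ‖Matrix.toEuclideanCLM (n := Fin d) (𝕜 := ℝ) (q N)‖ ≤ 1 / 2) :
    ∃ (σ : ℕ → ℕ) (qbar : Matrix (Fin d) (Fin d) ℝ),
      StrictMono σ ∧ Tendsto (fun k => q (σ k)) atTop (𝓝 qbar) := by
  have hK : IsCompact (Set.univ.pi fun _ : Fin d => Set.univ.pi fun _ : Fin d =>
      Set.Icc (-(1 / 2) : ℝ) (1 / 2)) :=
    isCompact_univ_pi fun _ => isCompact_univ_pi fun _ => isCompact_Icc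
  let x : ℕ → Fin d → Fin d → ℝ := q
  obtain ⟨a, -, σ, hσ, ha⟩ := hK.tendsto_subseq (x := x)
    fun N i _ j _ => abs_le.1 ((abs_apply_le_norm_toEuclideanCLM (q N) i j).trans (hq N))
  exact ⟨σ, a, hσ, ha⟩

theorem halfElliptic_of_tendsto {a : ℕ → Matrix (Fin d) (Fin d) ℝ}
    {a' : Matrix (Fin d) (Fin d) ℝ} (ha : ∀ k, HalfElliptic (a k))
    (hlim : Tendsto a atTop (𝓝 a')) : HalfElliptic a' := fun v =>
  ge_of_tendsto' (tendsto_finsetSum _ fun i _ => tendsto_finsetSum _ fun j _ =>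
    (tendsto_pi_nhds.1 (tendsto_pi_nhds.1 hlim i) j).mul_const _) fun k => ha k v

end Convergence

end GradientField
end

theorem mainTheorem3 (d L : ℕ) [NeZero L] (hLodd : Odd L) (hL : 1 < L)
    (q : ℕ → Matrix (Fin d) (Fin d) ℝ) (hsymm : ∀ N, (q N).IsSymm)
    (hq : ∀ N, ‖Matrix.toEuclideanCLM (n := Fin d) (𝕜 := ℝ) (q N)‖ ≤ 1 / 2) :
    -- the discrete operators are invertible
    (∀ N, IsUnit (GradientField.discreteElliptic d L N (q N))) ∧
    -- the parameters converge along a subsequence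
    (∃ (σ : ℕ → ℕ) (qbar : Matrix (Fin d) (Fin d) ℝ),
      StrictMono σ ∧ Tendsto (fun k => q (σ k)) atTop (𝓝 qbar)) ∧
    -- along every such subsequence the quadratic forms converge
    ∀ (σ : ℕ → ℕ) (qbar : Matrix (Fin d) (Fin d) ℝ),
      StrictMono σ → Tendsto (fun k => q (σ k)) atTop (𝓝 qbar) →
      qbar.IsSymm ∧
      (∀ f : UnitAddTorus (Fin d) → EuclideanSpace ℝ (Fin d), MemLp f 2 →
        GradientField.IsWeakSolution (1 + qbar) (GradientField.divStar f)
          (GradientField.continuumCov (1 + qbar) (GradientField.divStar f)) ∧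
        ∫ x, GradientField.continuumCov (1 + qbar) (GradientField.divStar f) x = 0 ∧
        (∀ v, GradientField.IsWeakSolution (1 + qbar) (GradientField.divStar f) v →
          ∃ c : ℝ, ∀ᵐ x, v x =
            GradientField.continuumCov (1 + qbar) (GradientField.divStar f) x + c) ∧
        Tendsto (fun k => GradientField.discreteForm (q (σ k))
            (GradientField.scaledAverage L (σ k) f)) atTop
          (𝓝 (GradientField.continuumForm (1 + qbar) f))) ∧
      (∀ f : UnitAddTorus (Fin d) → EuclideanSpace ℝ (Fin d), Continuous f →
        Tendsto (fun k => GradientField.discreteForm (q (σ k))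
            (GradientField.scaledPoint L (σ k) f)) atTop
          (𝓝 (GradientField.continuumForm (1 + qbar) f))) := by
  open GradientField in
  have hell : ∀ N, HalfElliptic (1 + q N) := fun N => halfElliptic_one_add (hq N)
  refine ⟨fun N => isUnit_discreteElliptic (hell N), exists_tendsto_subseq hq,
    fun σ qbar hσ hlim => ?_⟩
  have hbar : HalfElliptic (1 + qbar) :=
    halfElliptic_of_tendsto (fun k => hell (σ k)) (hlim.const_add 1)
  obtain ⟨K, hK⟩ := exists_solutionOperator hbar
  refine ⟨?_, fun f hf => ?_, fun f hf => ?_⟩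
  · refine Matrix.IsSymm.ext fun i j => ?_
    have h1 : ∀ i j, Tendsto (fun k => q (σ k) i j) atTop (𝓝 (qbar i j)) := fun i j =>
      tendsto_pi_nhds.1 (tendsto_pi_nhds.1 hlim i) j
    exact tendsto_nhds_unique (h1 j i) ((h1 i j).congr fun k => (hsymm (σ k)).apply j i)
  · obtain ⟨h1, h2⟩ := continuumCov_spec hbar hf
    refine ⟨h1, h2, fun v hv => ae_eq_add_const_of_isWeakSolution hbar hf h1 hv, ?_⟩
    rw [continuumForm_eq_inner hbar hf (hK _)]
    have h3 := tendsto_discreteForm_averageField hL hσ (fun k => hell (σ k)) hbar hlim hK hf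
    refine h3.congr fun k => ?_
    exact (discreteForm_eq_inner (q (σ k)) (averageField L (σ k) f)).symm
  · rw [continuumForm_eq_inner hbar (memLp_of_continuous hf) (hK _)]
    have h1 := tendsto_inner_discreteFlux hL hσ (fun k => hell (σ k)) hbar hlim hK ⟨f, hf⟩ ⟨f, hf⟩
    rw [contToL2_apply] at h1
    refine h1.congr fun k => ?_
    exact (discreteForm_eq_inner (q (σ k)) (pointField L (σ k) f)).symm
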